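/- Let $\mathbb N=\{1,2,\dots\}$ and let $\Omega_{os}$ be the space of pairs $(\xi,Q)$, where $\xi=(\xi_i)_{i\in\mathbb N}$ satisfies $\xi_1\ge\xi_2\ge\dots\ge 0$ and $\sum_i\xi_i\le 1$, and $Q=(q_{ij})_{i,j\in\mathbb N}$ is a real positive semi-definite symmetric matrix with $q_{ii}=1$ for all $i$; $\Omega_{os}$ carries the Borel $\sigma$-algebra (which is inherited from the product $\sigma$-algebra). A ROSt (random overlap structure) is a random variable with values in $\Omega_{os}$. We only consider ROSt's with infinitely many particles and no identical particles, i.e. such that almost surely $\xi_i>0$ for all $i$ and $|q_{ij}|<1$ for all $i\neq j$. For $r\in\mathbb N$ and measurable $\varphi:\mathbb R\to\mathbb R$ the evolution $\Phi_r$ with function $\varphi$ is $$\Phi_r(\xi,Q)=\left(\left(\frac{\xi_i e^{\varphi(\kappa_i)}}{\sum_j\xi_je^{\varphi(\kappa_j)}},\ i\in\mathbb N\right)_{\downarrow},\ (q_{\pi(i)\pi(j)})_{i,j\in\mathbb N}\right),$$ where, conditionally on $(\xi,Q)$, $\kappa=(\kappa_i)_{i\in\mathbb N}$ is a centered Gaussian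 field with covariance $(q_{ij}^r)_{i,j\in\mathbb N}$, $\downarrow$ denotes the decreasing rearrangement, and $\pi$ is the permutation of $\mathbb N$ that realizes it (equal weights keep their relative order). The ROSt is quasi-stationary under $\Phi_r$ with function $\varphi$ if $\Phi_r(\xi,Q)$ has the same law as $(\xi,Q)$. Let $\psi:\mathbb R\to\mathbb R$ be of class $C^2$ with bounded first and second derivatives, and such that the law of $\psi(Y)$ is absolutely continuous with respect to Lebesgue measure for $Y$ a standard Gaussian variable. Let $h\in\mathbb R$ be such that $\psi'(h)\neq0$, and let $r\in\mathbb N$. If $(\xi,Q)$ is quasi-stationary under $\Phi_r$ with function $y\mapsto\psi(\beta y+h)$ for all $\beta$ in a non-degenerate interval containing $0$, then there is $\varepsilon>0$ such that $(\xi,Q)$ is quasi-stationary under $\Phi_r$ with function $y\mapsto\lambda y$ for all $\lambda\in(-\varepsilon,\varepsilon)$. -/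

import Mathlib

open MeasureTheory ProbabilityTheory

namespace ROSt

/-- The set of pairs `(ξ, Q)`, where `ξ` is a non-increasing sequence of non-negative weights with
sum at most `1`, and `Q` is an infinite positive semi-definite symmetric matrix with `1` on the
diagonal. -/
def configs : Set ((ℕ → ℝ) × (ℕ → ℕ → ℝ)) :=
  {x | Antitone x.1 ∧ (∀ i, 0 ≤ x.1 i) ∧ Summable x.1 ∧ ∑' i, x.1 i ≤ 1 ∧
    (Matrix.of x.2).PosSemidef ∧ ∀ i, x.2 i i = 1}

/-- The space of overlap structures, with the σ-algebra inherited from the product σ-algebra (the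
Borel σ-algebra). The law of a ROSt is a probability measure on this space. -/
abbrev Space : Type := configs

/-- The weights `ξ`. -/
def Space.weight (x : Space) : ℕ → ℝ := x.1.1

/-- The overlap matrix `Q`. -/
def Space.overlap (x : Space) : ℕ → ℕ → ℝ := x.1.2

/-- The number of indices that come strictly before `i` when `w` is put in decreasing order
(equal entries are listed by increasing index). -/
noncomputable def rank (w : ℕ → ℝ) (i : ℕ) : ℕ∞ :=
  {j | w i < w j ∨ (w j = w i ∧ j < i)}.encard

/-- The reshuffling that puts `w` in decreasing order: `sortIndex w n` is the index whose
entry is in place `n` of the decreasing rearrangement of `w`. -/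
noncomputable def sortIndex (w : ℕ → ℝ) (n : ℕ) : ℕ :=
  sInf {i | rank w i = n}

/-- The weights `ξ_i e^{ψ(κ_i)}` after the evolution, before normalization and reordering. -/
noncomputable def rawWeight (ψ : ℝ → ℝ) (p : Space × (ℕ → ℝ)) (i : ℕ) : ℝ :=
  p.1.weight i * Real.exp (ψ (p.2 i))

/-- The competitive evolution: weights are multiplied by `e^{ψ(κ_i)}`, normalized to have sum `1`
and put in decreasing order; the overlaps are reindexed accordingly. -/
noncomputable def evolve (ψ : ℝ → ℝ) (p : Space × (ℕ → ℝ)) : (ℕ → ℝ) × (ℕ → ℕ → ℝ) :=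
  (fun m => rawWeight ψ p (sortIndex (rawWeight ψ p) m) / ∑' j, rawWeight ψ p j,
   fun m n => p.1.overlap (sortIndex (rawWeight ψ p) m) (sortIndex (rawWeight ψ p) n))

/-- `ν` is the law of a centered Gaussian field on `ℕ` with covariance `C`. -/
def IsGaussianField (ν : Measure (ℕ → ℝ)) (C : ℕ → ℕ → ℝ) : Prop :=
  IsGaussianProcess (fun (i : ℕ) (κ : ℕ → ℝ) => κ i) ν ∧
    (∀ i, ∫ κ, κ i ∂ν = 0) ∧ ∀ i j, ∫ κ, κ i * κ j ∂ν = C i j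

/-- A ROSt with law `P` is quasi-stationary under `Φ_r` with function `ψ`: if, conditionally on
`(ξ, Q)`, `κ` is a centered Gaussian field whose covariance is the `r`-th entrywise power of `Q`,
then the evolved pair has the same law as `(ξ, Q)`. The kernel `K` below, the conditional law of
`κ` given `(ξ, Q)`, is determined uniquely by its Gaussian finite dimensional distributions. -/
def QuasiStationary (r : ℕ) (ψ : ℝ → ℝ) (P : Measure Space) : Prop :=
  ∃ K : Kernel Space (ℕ → ℝ), IsMarkovKernel K ∧
    (∀ x : Space, IsGaussianField (K x) (fun i j => x.overlap i j ^ r)) ∧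
    (P ⊗ₘ K).map (evolve ψ) = P.map Subtype.val

/-- The class of functions `ψ` driving the evolution: `C²` with bounded first and second
derivatives, and such that `ψ(Y)` has an absolutely continuous law for `Y` standard Gaussian. -/
structure Admissible (ψ : ℝ → ℝ) : Prop where
  contDiff : ContDiff ℝ 2 ψ
  bounded_deriv : ∃ C, ∀ y, |deriv ψ y| ≤ C
  bounded_deriv_two : ∃ C, ∀ y, |deriv (deriv ψ) y| ≤ C
  absolutelyContinuous : (gaussianReal 0 1).map ψ ≪ volume

theorem measurable_rawWeight {ψ : ℝ → ℝ} (hψ : Measurable ψ) : Measurable (rawWeight ψ) := by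
  unfold rawWeight Space.weight
  fun_prop

theorem measurable_rank (i : ℕ) : Measurable fun w : ℕ → ℝ => rank w i := by
  unfold rank
  refine measurable_encard.comp (measurable_set_iff.2 fun j => ?_)
  refine measurable_to_prop ?_
  have h1 : MeasurableSet {w : ℕ → ℝ | w i < w j} :=
    measurableSet_lt (measurable_pi_apply i) (measurable_pi_apply j)
  have h2 : MeasurableSet {w : ℕ → ℝ | w j = w i} :=
    measurableSet_eq_fun (measurable_pi_apply j) (measurable_pi_apply i)
  have h3 : MeasurableSet {w : ℕ → ℝ | j < i} := MeasurableSet.const _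
  convert h1.union (h2.inter h3) using 1
  ext w
  simp

theorem measurable_sortIndex (n : ℕ) : Measurable fun w : ℕ → ℝ => sortIndex w n := by
  have hs : Measurable fun w : ℕ → ℝ => {i | rank w i = n} := by
    refine measurable_set_iff.2 fun i => ?_
    refine measurable_to_prop ?_
    convert measurable_rank i (measurableSet_singleton (n : ℕ∞)) using 1
    ext w
    simp
  refine measurable_to_countable' fun k => ?_
  have key : (fun w : ℕ → ℝ => sortIndex w n) ⁻¹' {k} =
      ({w | rank w k = n} ∩ ⋂ i ∈ Set.Iio k, {w | rank w i = n}ᶜ) ∪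
        {w | k = 0 ∧ ∀ i, ¬ rank w i = n} := by
    ext w
    simp only [Set.mem_preimage, Set.mem_singleton_iff, Set.mem_union, Set.mem_inter_iff,
      Set.mem_ofPred_eq, Set.mem_iInter, Set.mem_compl_iff, sortIndex, Set.mem_Iio]
    constructor
    · intro h
      by_cases hne : {i | rank w i = n}.Nonempty
      · left
        subst h
        exact ⟨Nat.sInf_mem hne, fun i hi => Nat.notMem_of_lt_sInf hi⟩
      · right
        rw [Set.not_nonempty_iff_eq_empty] at hne
        rw [hne, Nat.sInf_empty] at h
        exact ⟨h.symm, fun i hi => by simpa [hne] using (show i ∈ {i | rank w i = n} from hi)⟩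
    · rintro (⟨h1, h2⟩ | ⟨rfl, h2⟩)
      · refine le_antisymm (Nat.sInf_le h1) ?_
        by_contra! hlt
        have hm : sInf {i | rank w i = n} ∈ {i | rank w i = n} := Nat.sInf_mem ⟨k, h1⟩
        exact h2 _ hlt hm
      · simp [h2]
  have hr (i : ℕ) : MeasurableSet {w : ℕ → ℝ | rank w i = n} :=
    measurable_rank i (measurableSet_singleton (n : ℕ∞))
  rw [key]
  refine ((hr k).inter (MeasurableSet.biInter (Set.to_countable _)
    fun i _ => (hr i).compl)).union ?_
  have : {w : ℕ → ℝ | k = 0 ∧ ∀ i, ¬ rank w i = n} =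
      {w | k = 0} ∩ ⋂ i, {w | rank w i = n}ᶜ := by
    ext w; simp
  rw [this]
  exact (MeasurableSet.const _).inter (MeasurableSet.iInter fun i => (hr i).compl)

/-- The evolution is measurable, so that the law of the evolved pair is a genuine image measure. -/
theorem measurable_evolve {ψ : ℝ → ℝ} (hψ : Measurable ψ) : Measurable (evolve ψ) := by
  have hw := measurable_rawWeight hψ
  have hs (m : ℕ) : Measurable fun p : Space × (ℕ → ℝ) => sortIndex (rawWeight ψ p) m :=
    (measurable_sortIndex m).comp hw
  have hwi (i : ℕ) : Measurable fun p => rawWeight ψ p i := (measurable_pi_apply i).comp hw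
  have hsum : Measurable fun p => ∑' j, rawWeight ψ p j := Measurable.tsum hwi
  unfold evolve
  refine Measurable.prodMk (measurable_pi_lambda _ fun m => ?_)
    (measurable_pi_lambda _ fun m => measurable_pi_lambda _ fun n => ?_)
  · refine Measurable.div ?_ hsum
    exact (measurable_from_prod_countable_left (f := fun q : (Space × (ℕ → ℝ)) × ℕ =>
      rawWeight ψ q.1 q.2) hwi).comp (measurable_id.prodMk (hs m))
  · have ho (a : ℕ × ℕ) :
        Measurable fun p : Space × (ℕ → ℝ) => p.1.overlap a.1 a.2 := by
      unfold Space.overlap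
      fun_prop
    exact (measurable_from_prod_countable_left (f := fun q : (Space × (ℕ → ℝ)) × (ℕ × ℕ) =>
      q.1.1.overlap q.2.1 q.2.2) ho).comp (measurable_id.prodMk ((hs m).prodMk (hs n)))

end ROSt

/-! Run n independent evolutions with function ψ(β/√n · + h); each preserves the law P. The
covariance of the driving field depends on the overlaps only, so reordering the particles reorders
the field, and the n steps collapse into one evolution of the initial configuration, with exponent
the sum over l < n of ψ(β κ_l/√n + h) − ψ(h) (`evolve_evolve`, `map_evolve_powKernel`). Permutations
compose this way because ties almost surely do not occur: for i ≠ j the fields κ_i and κ_j are not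
collinear, and the level sets of ψ are null.

By Taylor's formula this sum is ψ'(h) β (∑ κ_l)/√n + ψ''(h)/2 · β² (∑ κ_l²)/n plus a negligible
remainder. The first term has exactly the law of ψ'(h) β κ. By the law of large numbers the second
tends to a constant that is the same for all particles, and normalization removes it. The limiting
evolution is therefore linear with slope ψ'(h) β.

To get almost sure limits, the n fields are built so that their normalized sum is one fixed field
(`coupled`). Coordinatewise convergence is upgraded to ℓ¹ convergence of the weights through
exponential moments bounded uniformly in n (`exists_lintegral_exp_le`), and the evolution is
ℓ¹-continuous where there are no ties (`tendsto_evolve`). Integrating bounded continuous functions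
then gives `QuasiStationary.linear`. The interval of admissible β may lie on one side of 0; slopes
of the other sign come from the symmetry of the Gaussian field. -/

open MeasureTheory ProbabilityTheory Filter Topology

namespace ROSt

/-! ### Decreasing rearrangement of positive sequences tending to zero -/

section Sorting

variable {w : ℕ → ℝ}

theorem finite_le_of_tendsto (h0 : Tendsto w cofinite (𝓝 0)) {a : ℝ} (ha : 0 < a) :
    {j | a ≤ w j}.Finite := by
  have := h0.eventually (gt_mem_nhds ha)
  simpa [Filter.eventually_cofinite] using this

theorem finite_above (hw : ∀ i, 0 < w i) (h0 : Tendsto w cofinite (𝓝 0)) (i : ℕ) :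
    {j | w i < w j ∨ (w j = w i ∧ j < i)}.Finite := by
  refine (finite_le_of_tendsto h0 (hw i)).subset ?_
  rintro j (h | ⟨h, -⟩)
  · exact h.le
  · exact h.ge

theorem rank_lt_rank (hw : ∀ i, 0 < w i) (h0 : Tendsto w cofinite (𝓝 0)) {i k : ℕ}
    (h : w k < w i ∨ (w i = w k ∧ i < k)) : rank w i < rank w k := by
  refine (finite_above hw h0 i).encard_lt_encard ((Set.ssubset_iff_of_subset ?_).2 ⟨i, h, ?_⟩)
  · rintro j (hj | ⟨hj, hj'⟩) <;> rcases h with h | ⟨h, h'⟩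
    · exact .inl (h.trans hj)
    · exact .inl (h ▸ hj)
    · exact .inl (hj ▸ h)
    · exact .inr ⟨hj.trans h, hj'.trans h'⟩
  · simp

theorem rank_injective (hw : ∀ i, 0 < w i) (h0 : Tendsto w cofinite (𝓝 0)) :
    Function.Injective (rank w) := by
  intro i k hik
  by_contra hne
  rcases lt_trichotomy (w i) (w k) with h | h | h
  · exact (rank_lt_rank hw h0 (.inl h)).ne hik.symm
  · rcases lt_or_gt_of_ne hne with h' | h'
    · exact (rank_lt_rank hw h0 (.inr ⟨h, h'⟩)).ne hik
    · exact (rank_lt_rank hw h0 (.inr ⟨h.symm, h'⟩)).ne hik.symm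
  · exact (rank_lt_rank hw h0 (.inl h)).ne hik

theorem rank_ne_top (hw : ∀ i, 0 < w i) (h0 : Tendsto w cofinite (𝓝 0)) (i : ℕ) :
    rank w i ≠ ⊤ := (finite_above hw h0 i).encard_lt_top.ne

/-- Finite, pairwise distinct ranks are unbounded, so some index i has rank above m. The indices
preceding i have distinct ranks below that of i, and there are as many of them as values available,
so every smaller value is taken. -/
theorem exists_rank_eq (hw : ∀ i, 0 < w i) (h0 : Tendsto w cofinite (𝓝 0)) (m : ℕ) :
    ∃ k, rank w k = m := by
  choose R hR using fun i => ENat.ne_top_iff_exists.1 (rank_ne_top hw h0 i)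
  have hRinj : Function.Injective R := fun i k h =>
    rank_injective hw h0 (by rw [← hR i, ← hR k, h])
  obtain ⟨i, hi⟩ : ∃ i, m < R i := by
    by_contra! h
    exact (Set.infinite_range_of_injective hRinj).not_bddAbove
      ⟨m, by rintro _ ⟨i, rfl⟩; exact h i⟩
  let A := (finite_above hw h0 i).toFinset
  have hA : A.card = R i := by
    have h1 : ((A : Set ℕ).encard) = rank w i := by simp [A, rank]
    rw [Set.encard_coe_eq_coe_finsetCard, ← hR i] at h1
    exact_mod_cast h1
  have hsub : A.image R ⊆ Finset.range (R i) := by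
    intro n hn
    obtain ⟨j, hj, rfl⟩ := Finset.mem_image.1 hn
    have hj' : w i < w j ∨ (w j = w i ∧ j < i) := by simpa [A] using hj
    have := rank_lt_rank hw h0 hj'
    rw [← hR i, ← hR j] at this
    simpa using this
  have heq : A.image R = Finset.range (R i) := by
    refine Finset.eq_of_subset_of_card_le hsub ?_
    rw [Finset.card_image_of_injective _ hRinj, hA, Finset.card_range]
  have hm : m ∈ A.image R := by rw [heq]; simpa using hi
  obtain ⟨k, -, hk⟩ := Finset.mem_image.1 hm
  exact ⟨k, by rw [← hR k, hk]⟩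

theorem sortIndex_eq (hw : ∀ i, 0 < w i) (h0 : Tendsto w cofinite (𝓝 0)) {k m : ℕ}
    (h : rank w k = m) : sortIndex w m = k := by
  have : {i | rank w i = m} = {k} := by
    ext i
    simp only [Set.mem_ofPred_eq, Set.mem_singleton_iff]
    exact ⟨fun hi => rank_injective hw h0 (hi.trans h.symm), fun hi => hi ▸ h⟩
  rw [sortIndex, this, csInf_singleton]

theorem rank_sortIndex (hw : ∀ i, 0 < w i) (h0 : Tendsto w cofinite (𝓝 0)) (m : ℕ) :
    rank w (sortIndex w m) = m := by
  obtain ⟨k, hk⟩ := exists_rank_eq hw h0 m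
  rwa [sortIndex_eq hw h0 hk]

theorem sortIndex_bijective (hw : ∀ i, 0 < w i) (h0 : Tendsto w cofinite (𝓝 0)) :
    Function.Bijective (sortIndex w) := by
  refine ⟨fun m n h => ?_, fun k => ?_⟩
  · have := rank_sortIndex hw h0 m
    rw [h, rank_sortIndex hw h0 n] at this
    exact_mod_cast this.symm
  · obtain ⟨m, hm⟩ := ENat.ne_top_iff_exists.1 (rank_ne_top hw h0 k)
    exact ⟨m, sortIndex_eq hw h0 hm.symm⟩

theorem antitone_sort (hw : ∀ i, 0 < w i) (h0 : Tendsto w cofinite (𝓝 0)) :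
    Antitone fun m => w (sortIndex w m) := by
  intro m n hmn
  by_contra! h
  have := rank_lt_rank hw h0 (.inl h)
  rw [rank_sortIndex hw h0, rank_sortIndex hw h0] at this
  exact absurd (by exact_mod_cast this) hmn.not_gt

/-- Injectivity is essential: ties are broken by index, a rule that relabelling by σ does not
respect. -/
theorem sortIndex_comp (hw : ∀ i, 0 < w i) (h0 : Tendsto w cofinite (𝓝 0))
    (hinj : Function.Injective w) {σ : ℕ → ℕ} (hσ : σ.Bijective) (m : ℕ) :
    σ (sortIndex (w ∘ σ) m) = sortIndex w m := by
  have h0' : Tendsto (w ∘ σ) cofinite (𝓝 0) := h0.comp hσ.1.tendsto_cofinite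
  refine (sortIndex_eq hw h0 ?_).symm
  rw [← rank_sortIndex (w := w ∘ σ) (fun i => hw _) h0' m]
  set i := sortIndex (w ∘ σ) m
  rw [rank, rank, ← hσ.1.encard_image {j | (w ∘ σ) i < (w ∘ σ) j ∨ _}]
  congr 1
  ext j
  obtain ⟨j, rfl⟩ := hσ.2 j
  simp only [Set.mem_ofPred_eq, Set.mem_image, hσ.1.eq_iff, exists_eq_right, Function.comp]
  constructor
  · rintro (h | ⟨h, h'⟩)
    · exact .inl h
    · exact absurd (hinj h) h'.ne
  · rintro (h | ⟨h, h'⟩)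
    · exact .inl h
    · exact absurd (hσ.1 (hinj h)) h'.ne

theorem sortIndex_mul_left {c : ℝ} (hc : 0 < c) (w : ℕ → ℝ) :
    sortIndex (fun i => c * w i) = sortIndex w := by
  have : rank (fun i => c * w i) = rank w := by
    ext i
    simp [rank, mul_lt_mul_iff_right₀ hc, mul_right_inj' hc.ne']
  funext m
  simp only [sortIndex, this]

/-- Around an entry of an injective sequence tending to zero there is a gap. -/
theorem exists_gap (hw : ∀ i, 0 < w i) (h0 : Tendsto w cofinite (𝓝 0))
    (hinj : Function.Injective w) (k : ℕ) : ∃ δ > 0, ∀ j, j ≠ k → δ ≤ |w j - w k| := by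
  have hfin := finite_le_of_tendsto h0 (half_pos (hw k))
  have hpos : ∀ j, j ≠ k → 0 < |w j - w k| := fun j hj =>
    abs_pos.2 (sub_ne_zero.2 fun h => hj (hinj h))
  obtain ⟨δ, hδ, hδ'⟩ : ∃ δ > 0, ∀ j ∈ hfin.toFinset, j ≠ k → δ ≤ |w j - w k| := by
    generalize hfin.toFinset = s
    induction s using Finset.induction with
    | empty => exact ⟨1, one_pos, by simp⟩
    | insert a s _ ih =>
      obtain ⟨δ, hδ, h⟩ := ih
      by_cases ha : a = k
      · refine ⟨δ, hδ, fun j hj hjk => ?_⟩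
        rcases Finset.mem_insert.1 hj with rfl | hj
        · exact absurd ha hjk
        · exact h j hj hjk
      · refine ⟨min δ |w a - w k|, lt_min hδ (hpos a ha), fun j hj hjk => ?_⟩
        rcases Finset.mem_insert.1 hj with rfl | hj
        · exact min_le_right _ _
        · exact (min_le_left _ _).trans (h j hj hjk)
  -- Entries below w k / 2 are at distance at least w k / 2; only finitely many others remain, and δ
  -- handles those.
  refine ⟨min δ (w k / 2), lt_min hδ (half_pos (hw k)), fun j hjk => ?_⟩
  by_cases hj : w k / 2 ≤ w j
  · exact (min_le_left _ _).trans (hδ' j (by simpa using hj) hjk)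
  · refine (min_le_right _ _).trans ?_
    rw [abs_sub_comm]
    exact le_trans (by linarith [not_le.1 hj]) (le_abs_self _)

/-- Places in the decreasing rearrangement are locally constant in the sup norm, at injective
positive sequences tending to zero. -/
theorem eventually_sortIndex_eq {ι : Type*} {l : Filter ι} {v : ι → ℕ → ℝ}
    (hw : ∀ i, 0 < w i) (h0 : Tendsto w cofinite (𝓝 0)) (hinj : Function.Injective w)
    (hv : ∀ n i, 0 < v n i) (hv0 : ∀ n, Tendsto (v n) cofinite (𝓝 0))
    (hvw : ∀ δ > 0, ∀ᶠ n in l, ∀ j, |v n j - w j| < δ) (m : ℕ) :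
    ∀ᶠ n in l, sortIndex (v n) m = sortIndex w m := by
  set k := sortIndex w m with hk
  obtain ⟨δ, hδ, hgap⟩ := exists_gap hw h0 hinj k
  -- Two entries moving by less than δ / 2 each cannot cross a gap δ, so every comparison with entry
  -- k, hence the rank of k, is unchanged.
  filter_upwards [hvw (δ / 2) (half_pos hδ)] with n hn
  refine sortIndex_eq (hv n) (hv0 n) ?_
  rw [← rank_sortIndex hw h0 m, ← hk]
  unfold rank
  congr 1
  ext j
  by_cases hjk : j = k
  · subst hjk; simp
  have h1 := hgap j hjk
  have h2 := abs_lt.1 (hn j)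
  have h3 := abs_lt.1 (hn k)
  have hne : w j ≠ w k := fun h => hjk (hinj h)
  have hiff : v n k < v n j ↔ w k < w j := by
    rcases lt_or_gt_of_ne hne with h | h
    · rw [abs_of_neg (by linarith)] at h1
      exact ⟨fun h' => by linarith [h2.1, h2.2, h3.1, h3.2], fun h' => absurd h h'.not_gt⟩
    · rw [abs_of_pos (by linarith)] at h1
      exact ⟨fun _ => h, fun _ => by linarith [h2.1, h2.2, h3.1, h3.2]⟩
  have hne' : v n j ≠ v n k := by
    intro h
    have : |w j - w k| < δ := by
      rw [abs_lt]; constructor <;> linarith [h2.1, h2.2, h3.1, h3.2]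
    linarith
  simp [hiff, hne, hne']

end Sorting

/-! ### Algebra and continuity of the evolution for a fixed configuration -/

section Evolve

variable {x : Space} {s t : ℕ → ℝ}

theorem rawWeight_pos (hx : ∀ i, 0 < x.weight i) (s : ℕ → ℝ) (i : ℕ) : 0 < rawWeight id (x, s) i :=
  mul_pos (hx i) (Real.exp_pos _)

theorem rawWeight_add_const (x : Space) (s : ℕ → ℝ) (c : ℝ) :
    rawWeight id (x, fun i => s i + c) = fun i => Real.exp c * rawWeight id (x, s) i := by
  funext i
  simp only [rawWeight, id, Real.exp_add]
  ring

/-- A common factor cancels in the normalization and does not affect the order. This is what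
discards the second order Taylor term in the limit. -/
theorem evolve_add_const (x : Space) (s : ℕ → ℝ) (c : ℝ) :
    evolve id (x, fun i => s i + c) = evolve id (x, s) := by
  unfold evolve
  rw [rawWeight_add_const, sortIndex_mul_left (Real.exp_pos c)]
  simp only [tsum_mul_left]
  congr 1
  funext m
  rw [mul_div_mul_left _ _ (Real.exp_pos c).ne']

theorem posSemidef_comp {Q : ℕ → ℕ → ℝ} (hQ : (Matrix.of Q).PosSemidef) (σ : ℕ → ℕ) :
    (Matrix.of fun m n => Q (σ m) (σ n)).PosSemidef := hQ.submatrix σ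

theorem evolve_mem_configs (hx : ∀ i, 0 < x.weight i) (hs : Summable (rawWeight id (x, s))) :
    evolve id (x, s) ∈ configs := by
  have hw := rawWeight_pos hx s
  have h0 := hs.tendsto_cofinite_zero
  have hb := sortIndex_bijective hw h0
  have hZ : 0 < ∑' j, rawWeight id (x, s) j := hs.tsum_pos (fun i => (hw i).le) 0 (hw 0)
  have hsum : HasSum (fun m => rawWeight id (x, s) (sortIndex (rawWeight id (x, s)) m))
      (∑' j, rawWeight id (x, s) j) :=
    (Equiv.ofBijective _ hb).hasSum_iff.2 hs.hasSum
  have hsum' := hsum.div_const (∑' j, rawWeight id (x, s) j)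
  rw [div_self hZ.ne'] at hsum'
  refine ⟨fun m n h => ?_, fun i => ?_, hsum'.summable, hsum'.tsum_eq.le, ?_, fun i => ?_⟩
  · exact div_le_div_of_nonneg_right (antitone_sort hw h0 h) hZ.le
  · exact (div_pos (hw _) hZ).le
  · exact posSemidef_comp x.2.2.2.2.2.1 _
  · exact x.2.2.2.2.2.2 _

/-- Two successive evolutions amount to a single one, as long as the final weights have no ties. -/
theorem evolve_evolve (hx : ∀ i, 0 < x.weight i) (hs : Summable (rawWeight id (x, s)))
    (hst : Summable (rawWeight id (x, s + t)))
    (hinj : Function.Injective (rawWeight id (x, s + t))) {y : Space}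
    (hy : y.1 = evolve id (x, s)) :
    evolve id (y, t ∘ sortIndex (rawWeight id (x, s))) = evolve id (x, s + t) := by
  have hw := rawWeight_pos hx s
  have h0 := hs.tendsto_cofinite_zero
  have hb := sortIndex_bijective hw h0
  have hZ : 0 < ∑' j, rawWeight id (x, s) j := hs.tsum_pos (fun i => (hw i).le) 0 (hw 0)
  set Z := ∑' j, rawWeight id (x, s) j
  set σ := sortIndex (rawWeight id (x, s))
  have hyw (m : ℕ) : y.weight m = rawWeight id (x, s) (σ m) / Z := by
    rw [Space.weight, hy]; rfl
  have hyo (m n : ℕ) : y.overlap m n = x.overlap (σ m) (σ n) := by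
    rw [Space.overlap, hy]; rfl
  have hraw : rawWeight id (y, t ∘ σ) = fun m => Z⁻¹ * (rawWeight id (x, s + t) ∘ σ) m := by
    funext m
    simp only [rawWeight, id, hyw, Function.comp, Pi.add_apply, Real.exp_add]
    ring
  -- After the first step the weights are the original ones relabelled by σ and scaled by Z⁻¹, so
  -- sorting them and undoing σ is the same as sorting once.
  have hsort (m : ℕ) : σ (sortIndex (rawWeight id (y, t ∘ σ)) m) =
      sortIndex (rawWeight id (x, s + t)) m := by
    rw [hraw, sortIndex_mul_left (inv_pos.2 hZ)]
    exact sortIndex_comp (rawWeight_pos hx _) hst.tendsto_cofinite_zero hinj hb m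
  have hsum : ∑' j, rawWeight id (y, t ∘ σ) j = Z⁻¹ * ∑' j, rawWeight id (x, s + t) j := by
    rw [hraw, tsum_mul_left]
    congr 1
    exact (Equiv.ofBijective _ hb).tsum_eq (rawWeight id (x, s + t))
  unfold evolve
  congr 1
  · funext m
    rw [hsum, congrFun hraw, Function.comp, hsort, mul_div_mul_left _ _ (inv_pos.2 hZ).ne']
  · funext m n
    dsimp only
    rw [hyo, hsort, hsort]

/-- The evolution is continuous in `ℓ¹` at weights without ties. -/
theorem tendsto_evolve {u : ℕ → ℕ → ℝ} (hx : ∀ i, 0 < x.weight i)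
    (hs : Summable (rawWeight id (x, s))) (hinj : Function.Injective (rawWeight id (x, s)))
    (hu : ∀ n, Summable (rawWeight id (x, u n)))
    (hlim : Tendsto (fun n => ∑' j, |rawWeight id (x, u n) j - rawWeight id (x, s) j|)
      atTop (𝓝 0)) :
    Tendsto (fun n => evolve id (x, u n)) atTop (𝓝 (evolve id (x, s))) := by
  have hsub (n : ℕ) : Summable fun j => |rawWeight id (x, u n) j - rawWeight id (x, s) j| :=
    ((hu n).sub hs).abs
  have hle (n j : ℕ) : |rawWeight id (x, u n) j - rawWeight id (x, s) j| ≤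
      ∑' j, |rawWeight id (x, u n) j - rawWeight id (x, s) j| :=
    (hsub n).le_tsum j fun _ _ => abs_nonneg _
  have hunif : ∀ δ > 0, ∀ᶠ n in atTop, ∀ j,
      |rawWeight id (x, u n) j - rawWeight id (x, s) j| < δ := fun δ hδ => by
    filter_upwards [hlim.eventually (gt_mem_nhds hδ)] with n hn j
    exact (hle n j).trans_lt hn
  have hsort (m : ℕ) := eventually_sortIndex_eq (rawWeight_pos hx s) hs.tendsto_cofinite_zero hinj
    (fun n => rawWeight_pos hx (u n)) (fun n => (hu n).tendsto_cofinite_zero) hunif m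
  have hZ : 0 < ∑' j, rawWeight id (x, s) j :=
    hs.tsum_pos (fun i => (rawWeight_pos hx s i).le) 0 (rawWeight_pos hx s 0)
  have hpt (j : ℕ) : Tendsto (fun n => rawWeight id (x, u n) j) atTop
      (𝓝 (rawWeight id (x, s) j)) := by
    rw [tendsto_iff_norm_sub_tendsto_zero]
    exact squeeze_zero (fun _ => norm_nonneg _) (fun n => hle n j) hlim
  have hZlim : Tendsto (fun n => ∑' j, rawWeight id (x, u n) j) atTop
      (𝓝 (∑' j, rawWeight id (x, s) j)) := by
    rw [tendsto_iff_norm_sub_tendsto_zero]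
    refine squeeze_zero (fun _ => norm_nonneg _) (fun n => ?_) hlim
    rw [← (hu n).tsum_sub hs]
    exact norm_tsum_le_tsum_norm (hsub n)
  refine Tendsto.prodMk_nhds (tendsto_pi_nhds.2 fun m => ?_)
    (tendsto_pi_nhds.2 fun m => tendsto_pi_nhds.2 fun n => ?_)
  · refine ((hpt (sortIndex (rawWeight id (x, s)) m)).div hZlim hZ.ne').congr' ?_
    filter_upwards [hsort m] with n hn
    rw [hn]; rfl
  · refine tendsto_const_nhds.congr' ?_
    filter_upwards [hsort m, hsort n] with k hm hn
    rw [hm, hn]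

end Evolve

/-! ### Measurability of the configuration space -/

section Configs

/-- The total mass is not continuous in the product topology; bounds on partial sums turn the
condition into an intersection of closed ones. -/
theorem configs_eq : configs = {x : (ℕ → ℝ) × (ℕ → ℕ → ℝ) |
    Antitone x.1 ∧ (∀ i, 0 ≤ x.1 i) ∧ (∀ n, ∑ i ∈ Finset.range n, x.1 i ≤ 1) ∧
    (Matrix.of x.2).PosSemidef ∧ ∀ i, x.2 i i = 1} := by
  ext x
  constructor
  · rintro ⟨h1, h2, h3, h4, h5⟩
    exact ⟨h1, h2, fun n => (h3.sum_le_tsum _ fun i _ => h2 i).trans h4, h5⟩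
  · rintro ⟨h1, h2, h3, h5⟩
    have hs := summable_of_sum_range_le h2 h3
    exact ⟨h1, h2, hs, hs.tsum_le_of_sum_range_le h3, h5⟩

theorem isClosed_configs : IsClosed configs := by
  rw [configs_eq]
  simp only [Antitone, Matrix.PosSemidef, Matrix.IsHermitian, ← Matrix.ext_iff,
    Matrix.conjTranspose_apply, Matrix.of_apply, Finsupp.sum, Set.ofPred_and, Set.ofPred_forall]
  have h1 (i : ℕ) : Continuous fun x : (ℕ → ℝ) × (ℕ → ℕ → ℝ) => x.1 i := by fun_prop
  have h2 (i j : ℕ) : Continuous fun x : (ℕ → ℝ) × (ℕ → ℕ → ℝ) => x.2 i j := by fun_prop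
  refine .inter ?_ (.inter ?_ (.inter ?_ (.inter (.inter ?_ ?_) ?_)))
  · exact isClosed_iInter fun i => isClosed_iInter fun j => isClosed_iInter fun _ =>
      isClosed_le (h1 _) (h1 _)
  · exact isClosed_iInter fun i => isClosed_le continuous_const (h1 i)
  · exact isClosed_iInter fun n => isClosed_le (by fun_prop) continuous_const
  · exact isClosed_iInter fun i => isClosed_iInter fun j => isClosed_eq (h2 _ _) (h2 _ _)
  · exact isClosed_iInter fun v => isClosed_le continuous_const (by fun_prop)
  · exact isClosed_iInter fun i => isClosed_eq (h2 i i) continuous_const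

theorem measurableEmbedding_val : MeasurableEmbedding (Subtype.val : Space → _) :=
  .subtype_coe isClosed_configs.measurableSet

end Configs

/-! ### Gaussian fields: uniqueness, symmetries, absence of ties -/

section GaussianField

variable {Ω : Type*} {mΩ : MeasurableSpace Ω} {μ : Measure Ω} {C : ℕ → ℕ → ℝ}

/-- The law of a centered Gaussian process is a Gaussian field. -/
theorem isGaussianField_map {X : ℕ → Ω → ℝ} (hm : ∀ i, Measurable (X i))
    (hX : IsGaussianProcess X μ) (h0 : ∀ i, ∫ ω, X i ω ∂μ = 0)
    (hC : ∀ i j, ∫ ω, X i ω * X j ω ∂μ = C i j) :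
    IsGaussianField (μ.map fun ω i => X i ω) C := by
  have hm' : Measurable fun ω i => X i ω := measurable_pi_lambda _ hm
  refine ⟨⟨fun I => ⟨?_⟩⟩, fun i => ?_, fun i j => ?_⟩
  · rw [Measure.map_map (by fun_prop) hm']
    exact (hX.hasGaussianLaw I).isGaussian_map
  · rw [integral_map hm'.aemeasurable (measurable_pi_apply i).aestronglyMeasurable, h0]
  · have hmul : Measurable fun κ : ℕ → ℝ => κ i * κ j := by fun_prop
    rw [integral_map hm'.aemeasurable hmul.aestronglyMeasurable, hC]

namespace IsGaussianField

variable {ν ν' : Measure (ℕ → ℝ)}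

theorem isProbabilityMeasure (h : IsGaussianField ν C) : IsProbabilityMeasure ν :=
  h.1.isProbabilityMeasure

theorem memLp_two (h : IsGaussianField ν C) (i : ℕ) : MemLp (fun κ : ℕ → ℝ => κ i) 2 ν :=
  (h.1.hasGaussianLaw_eval i).memLp_two

theorem integrable_mul (h : IsGaussianField ν C) (i j : ℕ) :
    Integrable (fun κ : ℕ → ℝ => κ i * κ j) ν := (h.memLp_two i).integrable_mul (h.memLp_two j)

theorem integrable (h : IsGaussianField ν C) (i : ℕ) : Integrable (fun κ : ℕ → ℝ => κ i) ν :=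
  (h.1.hasGaussianLaw_eval i).integrable

theorem charFunDual_map_restrict (h : IsGaussianField ν C) (I : Finset ℕ)
    (L : StrongDual ℝ (I → ℝ)) : charFunDual (ν.map I.restrict) L =
      Complex.exp (-(∑ i : I, ∑ j : I, L (Pi.single i 1) * L (Pi.single j 1) * C i j : ℝ) / 2) := by
  have := h.isProbabilityMeasure
  have hL (κ : ℕ → ℝ) : L (I.restrict κ) = ∑ i : I, L (Pi.single i 1) * κ i := by
    refine (LinearMap.pi_apply_eq_sum_univ (L : (I → ℝ) →ₗ[ℝ] ℝ) (I.restrict κ)).trans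
      (Finset.sum_congr rfl fun i _ => ?_)
    rw [smul_eq_mul, mul_comm, ContinuousLinearMap.coe_coe]
    congr 2
    ext j
    simp [Pi.single_apply, eq_comm]
  have hmean : ∫ κ, L (I.restrict κ) ∂ν = 0 := by
    simp_rw [hL]
    rw [integral_finsetSum (f := fun (i : I) (κ : ℕ → ℝ) => L (Pi.single i 1) * κ i) _
      fun i _ => (h.integrable i).const_mul _]
    simp [integral_const_mul, h.2.1]
  have hvar : Var[fun κ => L (I.restrict κ); ν] =
      ∑ i : I, ∑ j : I, L (Pi.single i 1) * L (Pi.single j 1) * C i j := by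
    rw [variance_of_integral_eq_zero (by fun_prop) hmean]
    simp_rw [hL, sq, Finset.sum_mul_sum]
    have hint (i j : I) : Integrable (fun κ : ℕ → ℝ =>
        L (Pi.single i 1) * κ i * (L (Pi.single j 1) * κ j)) ν := by
      refine ((h.integrable_mul i j).const_mul (L (Pi.single i 1) * L (Pi.single j 1))).congr
        (.of_forall fun κ => ?_)
      ring
    rw [integral_finsetSum _ fun i _ => integrable_finsetSum _ fun j _ => hint i j]
    refine Finset.sum_congr rfl fun i _ => ?_
    rw [integral_finsetSum _ fun j _ => hint i j]
    refine Finset.sum_congr rfl fun j _ => ?_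
    rw [← h.2.2 i j, ← integral_const_mul]
    refine integral_congr_ae (.of_forall fun κ => ?_)
    ring
  have := (h.1.hasGaussianLaw I).charFunDual_map_eq_fun L
  change charFunDual (ν.map I.restrict) L = Complex.exp ((∫ κ, L (I.restrict κ) ∂ν : ℝ) * _ -
    (Var[fun κ => L (I.restrict κ); ν] : ℝ) / 2) at this
  rw [this, hmean, hvar]
  congr 1
  simp [neg_div]

/-- A Gaussian field is determined by its covariance. -/
theorem unique (h : IsGaussianField ν C) (h' : IsGaussianField ν' C) : ν = ν' := by
  have := h.isProbabilityMeasure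
  have := h'.isProbabilityMeasure
  refine IsProjectiveLimit.unique (P := fun I : Finset ℕ => ν'.map I.restrict) (fun I => ?_)
    fun I => rfl
  have : IsProbabilityMeasure (ν.map I.restrict) :=
    Measure.isProbabilityMeasure_map (by fun_prop)
  have : IsProbabilityMeasure (ν'.map I.restrict) :=
    Measure.isProbabilityMeasure_map (by fun_prop)
  refine Measure.ext_of_charFunDual ?_
  ext L
  rw [h.charFunDual_map_restrict, h'.charFunDual_map_restrict]

theorem map_comp (h : IsGaussianField ν C) (σ : ℕ → ℕ) :
    IsGaussianField (ν.map fun κ => κ ∘ σ) fun i j => C (σ i) (σ j) :=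
  isGaussianField_map (X := fun i (κ : ℕ → ℝ) => κ (σ i)) (fun _ => measurable_pi_apply _)
    (h.1.comp_right σ) (fun _ => h.2.1 _) fun _ _ => h.2.2 _ _

theorem map_neg (h : IsGaussianField ν C) : IsGaussianField (ν.map fun κ i => -κ i) C := by
  refine isGaussianField_map (X := fun i (κ : ℕ → ℝ) => -κ i) (fun i => by fun_prop) ?_ (fun i => ?_)
    fun i j => ?_
  · simpa using h.1.smul fun _ => (-1 : ℝ)
  · rw [integral_neg, h.2.1, neg_zero]
  · simpa using h.2.2 i j

theorem map_eval (h : IsGaussianField ν C) {i : ℕ} (hi : C i i = 1) :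
    ν.map (fun κ => κ i) = gaussianReal 0 1 := by
  have := h.isProbabilityMeasure
  rw [(h.1.hasGaussianLaw_eval i).map_eq_gaussianReal, h.2.1,
    variance_of_integral_eq_zero (measurable_pi_apply i).aemeasurable (h.2.1 i)]
  simp_rw [sq]
  rw [h.2.2, hi, Real.toNNReal_one]

end IsGaussianField

/-- If the level sets of `f` are negligible, then `f κ_i` and `f κ_j` almost surely do not differ
by a given constant, unless `κ_i` and `κ_j` are collinear. -/
theorem ae_sub_ne {ν : Measure (ℕ → ℝ)} (h : IsGaussianField ν C) {f : ℝ → ℝ} (hf : Measurable f)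
    (hlev : ∀ c, volume {y | f y = c} = 0) {i j : ℕ} (hi : C i i = 1) (hj : C j j = 1)
    (hij : |C i j| < 1) (c : ℝ) : ∀ᵐ κ ∂ν, f (κ i) - f (κ j) ≠ c := by
  have := h.isProbabilityMeasure
  set ρ := C i j
  -- Orthogonalization: κ_j − ρ κ_i is uncorrelated with κ_i, hence independent of it, and has
  -- variance 1 − ρ² > 0. Given κ_i, the bad event is that a variable with a density falls in a null
  -- level set.
  have hpair : HasGaussianLaw (fun κ : ℕ → ℝ => (κ i, κ j - ρ * κ i)) ν := by
    have := (h.1.hasGaussianLaw_prodMk (s := i) (t := j)).map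
      ((ContinuousLinearMap.fst ℝ ℝ ℝ).prod
        (ContinuousLinearMap.snd ℝ ℝ ℝ - ρ • ContinuousLinearMap.fst ℝ ℝ ℝ))
    simpa [Function.comp_def] using this
  have hρ : ρ ^ 2 < 1 := by rw [sq_lt_one_iff_abs_lt_one]; exact hij
  have hmean : ∫ κ, (κ j - ρ * κ i) ∂ν = 0 := by
    rw [integral_sub (h.integrable j) ((h.integrable i).const_mul _), integral_const_mul, h.2.1,
      h.2.1]
    simp
  have hcov : cov[fun κ : ℕ → ℝ => κ i, fun κ => κ j - ρ * κ i; ν] = 0 := by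
    have hmem : MemLp (fun κ : ℕ → ℝ => κ j - ρ * κ i) 2 ν :=
      (h.memLp_two j).sub ((h.memLp_two i).const_mul ρ)
    rw [covariance_eq_sub (h.memLp_two i) hmem, h.2.1]
    have : ∫ κ, κ i * (κ j - ρ * κ i) ∂ν = 0 := by
      have he (κ : ℕ → ℝ) : κ i * (κ j - ρ * κ i) = κ i * κ j - ρ * (κ i * κ i) := by ring
      simp_rw [he]
      rw [integral_sub (h.integrable_mul i j) ((h.integrable_mul i i).const_mul _),
        integral_const_mul, h.2.2, h.2.2, hi]
      ring
    simpa using this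
  have hvar : Var[fun κ : ℕ → ℝ => κ j - ρ * κ i; ν] = 1 - ρ ^ 2 := by
    rw [variance_of_integral_eq_zero (by fun_prop) hmean]
    have he (κ : ℕ → ℝ) : (κ j - ρ * κ i) ^ 2 =
        κ j * κ j - (2 * ρ * (κ i * κ j) - ρ ^ 2 * (κ i * κ i)) := by ring
    simp_rw [he]
    have hint : Integrable
        (fun κ : ℕ → ℝ => 2 * ρ * (κ i * κ j) - ρ ^ 2 * (κ i * κ i)) ν :=
      ((h.integrable_mul i j).const_mul _).sub ((h.integrable_mul i i).const_mul _)
    rw [integral_sub (h.integrable_mul j j) hint,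
      integral_sub ((h.integrable_mul i j).const_mul _) ((h.integrable_mul i i).const_mul _),
      integral_const_mul, integral_const_mul, h.2.2, h.2.2, h.2.2, hi, hj]
    ring
  have hlaw : ν.map (fun κ => κ j - ρ * κ i) ≪ volume := by
    rw [hpair.snd.map_eq_gaussianReal, hvar]
    exact gaussianReal_absolutelyContinuous _ (by simpa using hρ)
  have hindep := hpair.indepFun_of_covariance_eq_zero hcov
  have hprod := (indepFun_iff_map_prod_eq_prod_map_map (measurable_pi_apply i).aemeasurable
    (by fun_prop)).1 hindep
  have hmeas : MeasurableSet {p : ℝ × ℝ | f p.1 - f (p.2 + ρ * p.1) = c} :=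
    measurableSet_eq_fun (by fun_prop) measurable_const
  have hzero : ν.map (fun κ : ℕ → ℝ => (κ i, κ j - ρ * κ i))
      {p : ℝ × ℝ | f p.1 - f (p.2 + ρ * p.1) = c} = 0 := by
    rw [hprod, Measure.measure_prod_null hmeas]
    refine .of_forall fun u => hlaw ?_
    have : Prod.mk u ⁻¹' {p : ℝ × ℝ | f p.1 - f (p.2 + ρ * p.1) = c} =
        (fun v => v + ρ * u) ⁻¹' {y | f y = f u - c} := by
      ext v
      simp only [Set.mem_preimage, Set.mem_ofPred_eq]
      constructor <;> intro hv <;> linarith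
    rw [this, measure_preimage_add_right, hlev]
  rw [Measure.map_apply (by fun_prop) hmeas] at hzero
  rw [ae_iff]
  convert hzero using 2
  ext κ
  simp

end GaussianField

/-! ### Analytic estimates for ψ -/

namespace Admissible

variable {ψ : ℝ → ℝ}

theorem differentiable (hψ : Admissible ψ) : Differentiable ℝ ψ :=
  hψ.contDiff.differentiable (by norm_num)

theorem differentiable_deriv (hψ : Admissible ψ) : Differentiable ℝ (deriv ψ) :=
  ((contDiff_succ_iff_deriv (n := 1)).1 hψ.contDiff).2.2.differentiable (by norm_num)

theorem measurable (hψ : Admissible ψ) : Measurable ψ := hψ.differentiable.continuous.measurable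

/-- The law of ψ(Y) has no atoms, and Lebesgue measure is absolutely continuous with respect to the
Gaussian law. -/
theorem volume_level (hψ : Admissible ψ) (c : ℝ) : volume {y | ψ y = c} = 0 := by
  have h1 : (gaussianReal 0 1).map ψ {c} = 0 := hψ.absolutelyContinuous (by simp)
  rw [Measure.map_apply hψ.measurable (measurableSet_singleton c)] at h1
  exact gaussianReal_absolutelyContinuous' 0 one_ne_zero h1

theorem volume_level_affine (hψ : Admissible ψ) {a : ℝ} (ha : a ≠ 0) (h d c : ℝ) :
    volume {y | ψ (a * y + h) - d = c} = 0 := by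
  have h1 := hψ.volume_level (c + d)
  rw [← measure_preimage_add_right volume h] at h1
  have h2 := Real.volume_preimage_mul_left ha ((fun y => y + h) ⁻¹' {y | ψ y = c + d})
  rw [h1, mul_zero] at h2
  convert h2 using 2
  ext y
  simp [sub_eq_iff_eq_add]

/-- Linear approximation with a global quadratic error bound, together with the Lipschitz bound. -/
theorem exists_bounds (hψ : Admissible ψ) (h : ℝ) : ∃ C, 0 ≤ C ∧ ∀ u,
    |ψ (u + h) - ψ h| ≤ C * |u| ∧ |ψ (u + h) - ψ h - deriv ψ h * u| ≤ C * u ^ 2 := by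
  obtain ⟨C₁, h₁⟩ := hψ.bounded_deriv
  obtain ⟨C₂, h₂⟩ := hψ.bounded_deriv_two
  have hlip (f : ℝ → ℝ) (hf : Differentiable ℝ f) {C : ℝ} (hC : ∀ y, |deriv f y| ≤ C) (a b : ℝ) :
      |f a - f b| ≤ C * |a - b| := by
    simpa using Convex.norm_image_sub_le_of_norm_deriv_le (s := Set.univ) (f := f)
      (fun y _ => hf y) (fun y _ => hC y) convex_univ (Set.mem_univ b) (Set.mem_univ a)
  refine ⟨max C₁ C₂, ((abs_nonneg _).trans (h₁ 0)).trans (le_max_left _ _), fun u => ⟨?_, ?_⟩⟩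
  · refine (hlip ψ hψ.differentiable h₁ _ _).trans ?_
    rw [add_sub_cancel_right]
    exact mul_le_mul_of_nonneg_right (le_max_left _ _) (abs_nonneg _)
  · have key := Convex.norm_image_sub_le_of_norm_deriv_le (s := Metric.closedBall h |u|)
      (f := fun v => ψ v - deriv ψ h * v) (C := C₂ * |u|) (x := h) (y := u + h)
      (fun y _ => ((hψ.differentiable y).sub ((differentiableAt_id).const_mul _)))
      (fun y hy => ?_) (convex_closedBall _ _) (Metric.mem_closedBall_self (abs_nonneg _))
      (by simp)
    · simp only [Real.norm_eq_abs, add_sub_cancel_right] at key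
      have e : ψ (u + h) - deriv ψ h * (u + h) - (ψ h - deriv ψ h * h) =
        ψ (u + h) - ψ h - deriv ψ h * u := by ring
      rw [e, mul_assoc, abs_mul_abs_self, ← sq] at key
      exact key.trans (mul_le_mul_of_nonneg_right (le_max_right _ _) (sq_nonneg _))
    · have hd : HasDerivAt (fun v => ψ v - deriv ψ h * v) (deriv ψ y - deriv ψ h * 1) y :=
        (hψ.differentiable y).hasDerivAt.sub ((hasDerivAt_id y).const_mul _)
      rw [hd.deriv, mul_one, Real.norm_eq_abs]
      refine (hlip _ hψ.differentiable_deriv h₂ _ _).trans ?_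
      rw [Metric.mem_closedBall, Real.dist_eq] at hy
      exact mul_le_mul_of_nonneg_left hy ((abs_nonneg _).trans (h₂ 0))

/-- Exponential moments of a small increment of `ψ` along a Gaussian. -/
theorem exists_lintegral_exp_le (hψ : Admissible ψ) (h M : ℝ) : ∃ A : ℝ, ∀ a, |a| ≤ M →
    ∫⁻ y, ENNReal.ofReal (Real.exp (ψ (a * y + h) - ψ h)) ∂(gaussianReal 0 1) ≤
      ENNReal.ofReal (Real.exp (A * a ^ 2)) := by
  obtain ⟨C, hC, hb⟩ := hψ.exists_bounds h
  -- C * M bounds the growth of the exponent |z|; the extra 1 absorbs y² ≤ 2 e^{|y|}.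
  set D := C * M + 1
  have hint : Integrable (fun y => 4 * (C + C ^ 2) * (Real.exp (D * y) + Real.exp (-D * y)))
      (gaussianReal 0 1) :=
    ((integrable_exp_mul_gaussianReal D).add (integrable_exp_mul_gaussianReal (-D))).const_mul _
  have hid : Integrable (fun y : ℝ => y) (gaussianReal 0 1) :=
    (memLp_id_gaussianReal 1).integrable le_rfl
  refine ⟨∫ y, 4 * (C + C ^ 2) * (Real.exp (D * y) + Real.exp (-D * y)) ∂(gaussianReal 0 1),
    fun a ha => ?_⟩
  have hM : 0 ≤ M := (abs_nonneg a).trans ha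
  -- The term linear in y has mean zero, so only order a² survives integration. This makes the n-th
  -- power bounded when a = β/√n.
  have hpt (y : ℝ) : Real.exp (ψ (a * y + h) - ψ h) ≤ 1 + deriv ψ h * a * y +
      a ^ 2 * (4 * (C + C ^ 2) * (Real.exp (D * y) + Real.exp (-D * y))) := by
    set z := ψ (a * y + h) - ψ h
    obtain ⟨h1, h2⟩ := hb (a * y)
    have hz : |z| ≤ C * M * |y| := by
      refine h1.trans ?_
      rw [abs_mul, mul_assoc]
      gcongr
    have hexp : Real.exp z ≤ 1 + z + z ^ 2 * Real.exp |z| := by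
      have key := Complex.norm_exp_sub_sum_le_norm_mul_exp (z : ℂ) 2
      have e : Complex.exp z - ∑ m ∈ Finset.range 2, (z : ℂ) ^ m / (m.factorial : ℂ) =
          ((Real.exp z - (1 + z) : ℝ) : ℂ) := by
        simp [Finset.sum_range_succ]
      rw [e, Complex.norm_real, Complex.norm_real, Real.norm_eq_abs, Real.norm_eq_abs, sq_abs]
        at key
      linarith [(le_abs_self _).trans key]
    have hz2 : z ^ 2 ≤ C ^ 2 * (a ^ 2 * y ^ 2) := by
      rw [← sq_abs z]
      calc |z| ^ 2 ≤ (C * |a * y|) ^ 2 := by gcongr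
        _ = _ := by rw [mul_pow, sq_abs, mul_pow]
    have hz1 : z ≤ deriv ψ h * a * y + C * (a ^ 2 * y ^ 2) := by
      have := (le_abs_self _).trans h2
      rw [mul_pow] at this
      linarith
    have hy2 : y ^ 2 ≤ 2 * Real.exp |y| := by
      have := Real.quadratic_le_exp_of_nonneg (abs_nonneg y)
      rw [sq_abs] at this
      linarith [abs_nonneg y]
    have hyD : Real.exp (C * M * |y|) * Real.exp |y| ≤ Real.exp (D * y) + Real.exp (-D * y) := by
      rw [← Real.exp_add, ← add_one_mul]
      change Real.exp (D * |y|) ≤ _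
      rcases abs_cases y with ⟨h, -⟩ | ⟨h, -⟩ <;> rw [h]
      · linarith [Real.exp_pos (-D * y)]
      · rw [mul_neg, neg_mul]
        linarith [Real.exp_pos (D * y)]
    have hone : 1 ≤ Real.exp (C * M * |y|) := Real.one_le_exp (by positivity)
    have hone' : 0 < Real.exp |y| := Real.exp_pos _
    calc Real.exp z ≤ 1 + z + z ^ 2 * Real.exp |z| := hexp
      _ ≤ 1 + (deriv ψ h * a * y + C * (a ^ 2 * y ^ 2)) +
          C ^ 2 * (a ^ 2 * y ^ 2) * Real.exp (C * M * |y|) := by gcongr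
      _ ≤ 1 + (deriv ψ h * a * y + C * (a ^ 2 * y ^ 2) * Real.exp (C * M * |y|)) +
          C ^ 2 * (a ^ 2 * y ^ 2) * Real.exp (C * M * |y|) := by
        have := le_mul_of_one_le_right (by positivity : 0 ≤ C * (a ^ 2 * y ^ 2)) hone
        gcongr
      _ = 1 + deriv ψ h * a * y + a ^ 2 * ((C + C ^ 2) * (y ^ 2 * Real.exp (C * M * |y|))) := by
        ring
      _ ≤ 1 + deriv ψ h * a * y +
          a ^ 2 * ((C + C ^ 2) * (4 * (Real.exp (D * y) + Real.exp (-D * y)))) := by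
        have : y ^ 2 * Real.exp (C * M * |y|) ≤ 4 * (Real.exp (D * y) + Real.exp (-D * y)) := by
          calc y ^ 2 * Real.exp (C * M * |y|)
              ≤ 2 * Real.exp |y| * Real.exp (C * M * |y|) := by gcongr
            _ = 2 * (Real.exp (C * M * |y|) * Real.exp |y|) := by ring
            _ ≤ 2 * (Real.exp (D * y) + Real.exp (-D * y)) := by gcongr
            _ ≤ _ := by linarith [Real.exp_pos (D * y), Real.exp_pos (-D * y)]
        gcongr
      _ = _ := by ring
  have hlin : Integrable (fun y => 1 + deriv ψ h * a * y) (gaussianReal 0 1) :=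
    (integrable_const 1).add (hid.const_mul _)
  have hint' : Integrable (fun y => 1 + deriv ψ h * a * y +
      a ^ 2 * (4 * (C + C ^ 2) * (Real.exp (D * y) + Real.exp (-D * y)))) (gaussianReal 0 1) :=
    hlin.add (hint.const_mul _)
  calc _ ≤ ∫⁻ y, ENNReal.ofReal (1 + deriv ψ h * a * y +
        a ^ 2 * (4 * (C + C ^ 2) * (Real.exp (D * y) + Real.exp (-D * y)))) ∂(gaussianReal 0 1) :=
      lintegral_mono fun y => ENNReal.ofReal_le_ofReal (hpt y)
    _ = ENNReal.ofReal (1 + a ^ 2 *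
        ∫ y, 4 * (C + C ^ 2) * (Real.exp (D * y) + Real.exp (-D * y)) ∂(gaussianReal 0 1)) := by
      rw [← ofReal_integral_eq_lintegral_ofReal hint'
        (.of_forall fun y => (Real.exp_pos _).le.trans (hpt y)),
        integral_add hlin (hint.const_mul _),
        integral_add (integrable_const 1) (hid.const_mul _), integral_const_mul,
        integral_const_mul, integral_id_gaussianReal]
      simp
    _ ≤ _ := by
      refine ENNReal.ofReal_le_ofReal ?_
      rw [add_comm, mul_comm]
      exact Real.add_one_le_exp _

/-- Second order Taylor expansion. -/
theorem taylor_isLittleO (hψ : Admissible ψ) (h : ℝ) :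
    (fun u => ψ (u + h) - ψ h - deriv ψ h * u - deriv (deriv ψ) h / 2 * u ^ 2)
      =o[𝓝 0] fun u => u ^ 2 := by
  have h1 := _root_.taylor_isLittleO_univ (x₀ := h) (n := 2) hψ.contDiff
  have h2 : Tendsto (fun u : ℝ => u + h) (𝓝 0) (𝓝 h) := by
    have : Continuous fun u : ℝ => u + h := by fun_prop
    simpa using this.tendsto 0
  refine (h1.comp_tendsto h2).congr (fun u => ?_) fun u => ?_
  · simp only [Function.comp, taylorWithinEval_succ, taylor_within_zero_eval,
      iteratedDerivWithin_univ, iteratedDeriv_succ, iteratedDeriv_zero]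
    simp
    ring
  · simp

end Admissible

/-! ### Sums over triangular arrays -/

/-- Sums of small increments of a function only depend, in the limit, on the sum of the arguments
and the sum of their squares. -/
theorem tendsto_sum_of_taylor {f : ℝ → ℝ} {a b : ℝ}
    (hf : (fun u => f u - a * u - b * u ^ 2) =o[𝓝 0] fun u => u ^ 2)
    {u : ℕ → ℕ → ℝ} {c q : ℝ}
    (hsum : Tendsto (fun n => ∑ l ∈ Finset.range n, u n l) atTop (𝓝 c))
    (hsq : Tendsto (fun n => ∑ l ∈ Finset.range n, u n l ^ 2) atTop (𝓝 q))
    (hmax : ∀ ε > 0, ∀ᶠ n in atTop, ∀ l < n, |u n l| < ε) :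
    Tendsto (fun n => ∑ l ∈ Finset.range n, f (u n l)) atTop (𝓝 (a * c + b * q)) := by
  have hrem : Tendsto (fun n => ∑ l ∈ Finset.range n,
      (f (u n l) - a * u n l - b * u n l ^ 2)) atTop (𝓝 0) := by
    have ho : (fun n => ∑ l ∈ Finset.range n, (f (u n l) - a * u n l - b * u n l ^ 2)) =o[atTop]
        fun n => ∑ l ∈ Finset.range n, u n l ^ 2 := by
      refine Asymptotics.isLittleO_iff.2 fun c hc => ?_
      obtain ⟨ε, hε, hεf⟩ := Metric.eventually_nhds_iff.1 (Asymptotics.isLittleO_iff.1 hf hc)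
      filter_upwards [hmax ε hε] with n hn
      rw [Real.norm_of_nonneg (Finset.sum_nonneg fun l _ => sq_nonneg (u n l)), Finset.mul_sum]
      refine (norm_sum_le _ _).trans (Finset.sum_le_sum fun l hl => ?_)
      have := hεf (y := u n l) (by simpa [Real.dist_eq] using hn l (Finset.mem_range.1 hl))
      rwa [Real.norm_of_nonneg (sq_nonneg (u n l))] at this
    exact (Asymptotics.isLittleO_one_iff ℝ).1 (ho.trans_isBigO (hsq.isBigO_one ℝ))
  have := ((hsum.const_mul a).add (hsq.const_mul b)).add hrem
  rw [add_zero] at this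
  refine this.congr fun n => ?_
  rw [Finset.mul_sum, Finset.mul_sum, ← Finset.sum_add_distrib, ← Finset.sum_add_distrib]
  exact Finset.sum_congr rfl fun l _ => by ring

/-- If Cesàro averages converge then the terms are `o(n)`. -/
theorem tendsto_div_of_tendsto_average {v : ℕ → ℝ} {c : ℝ}
    (hv : Tendsto (fun n : ℕ => (∑ l ∈ Finset.range n, v l) / n) atTop (𝓝 c)) :
    Tendsto (fun n : ℕ => v n / (n + 1 : ℕ)) atTop (𝓝 0) := by
  have h1 := hv.comp (tendsto_add_atTop_nat 1)
  have h2 : Tendsto (fun n : ℕ => (n : ℝ) / (n + 1 : ℕ)) atTop (𝓝 1) := by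
    simpa using tendsto_natCast_div_add_atTop (1 : ℝ)
  have h3 := h1.sub (hv.mul h2)
  rw [mul_one, sub_self] at h3
  refine h3.congr' ?_
  filter_upwards [eventually_ge_atTop 1] with n hn
  have hn' : (n : ℝ) ≠ 0 := by positivity
  simp only [Function.comp, Finset.sum_range_succ]
  field_simp
  ring

/-- Convergent averages of v² force v_l² < ε² (l + 1) for large l, and l + 1 ≤ n for l < n; the
finitely many small l are handled by √n → ∞. -/
theorem eventually_max_lt {v : ℕ → ℝ} {c : ℝ}
    (hv : Tendsto (fun n : ℕ => (∑ l ∈ Finset.range n, v l ^ 2) / n) atTop (𝓝 c)) :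
    ∀ ε > 0, ∀ᶠ n : ℕ in atTop, ∀ l < n, |v l / √n| < ε := by
  intro ε hε
  have h1 := (tendsto_div_of_tendsto_average hv).eventually (gt_mem_nhds (pow_pos hε 2))
  obtain ⟨N, hN⟩ := eventually_atTop.1 h1
  have h2 : ∀ᶠ n : ℕ in atTop, ∀ l ∈ Finset.range N, |v l / √n| < ε := by
    refine (Finset.eventually_all _).2 fun l _ => ?_
    have h3 : Tendsto (fun n : ℕ => |v l / √n|) atTop (𝓝 |0|) :=
      (tendsto_const_nhds.div_atTop
        (Real.tendsto_sqrt_atTop.comp tendsto_natCast_atTop_atTop)).abs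
    rw [abs_zero] at h3
    exact h3.eventually (gt_mem_nhds hε)
  filter_upwards [h2] with n hn l hl
  by_cases hlN : l < N
  · exact hn l (Finset.mem_range.2 hlN)
  · have hlt := hN l (not_lt.1 hlN)
    have hn0 : (0 : ℝ) < n := by exact_mod_cast (Nat.zero_le l).trans_lt hl
    refine abs_lt_of_sq_lt_sq ?_ hε.le
    rw [div_pow, Real.sq_sqrt hn0.le, div_lt_iff₀ hn0]
    rw [div_lt_iff₀ (by positivity)] at hlt
    have : ((l + 1 : ℕ) : ℝ) ≤ n := by exact_mod_cast hl
    exact hlt.trans_le (by gcongr)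

/-- The array obtained from `v` by replacing its averages over `[0, n)` by `c / √n`. -/
noncomputable def recenter (c : ℝ) (v : ℕ → ℝ) (n l : ℕ) : ℝ :=
  c / √n + (v l - (∑ m ∈ Finset.range n, v m) / n)

/-- After recentering, the arguments sum to β c exactly for n ≥ 1, and their squares sum to β² in
the limit. -/
theorem tendsto_sum_recenter {f : ℝ → ℝ} {a b : ℝ}
    (hf : (fun u => f u - a * u - b * u ^ 2) =o[𝓝 0] fun u => u ^ 2)
    {v : ℕ → ℝ} (c β : ℝ)
    (hv : Tendsto (fun n : ℕ => (∑ l ∈ Finset.range n, v l) / n) atTop (𝓝 0))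
    (hv2 : Tendsto (fun n : ℕ => (∑ l ∈ Finset.range n, v l ^ 2) / n) atTop (𝓝 1)) :
    Tendsto (fun n : ℕ => ∑ l ∈ Finset.range n, f (β / √n * recenter c v n l)) atTop
      (𝓝 (a * (β * c) + b * β ^ 2)) := by
  have hsqrt : Tendsto (fun n : ℕ => √(n : ℝ)) atTop atTop :=
    Real.tendsto_sqrt_atTop.comp tendsto_natCast_atTop_atTop
  have hc0 (d : ℝ) : Tendsto (fun n : ℕ => d / √(n : ℝ)) atTop (𝓝 0) :=
    tendsto_const_nhds.div_atTop hsqrt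
  refine tendsto_sum_of_taylor hf ?_ ?_ ?_
  · refine tendsto_const_nhds.congr' ?_
    filter_upwards [eventually_ge_atTop 1] with n hn
    have hn' : (0 : ℝ) < n := by exact_mod_cast hn
    simp only [recenter]
    rw [← Finset.mul_sum, Finset.sum_add_distrib, Finset.sum_sub_distrib]
    simp only [Finset.sum_const, Finset.card_range, nsmul_eq_mul]
    rw [mul_div_cancel₀ _ hn'.ne', sub_self, add_zero]
    have h1 : √(n : ℝ) * √n = n := Real.mul_self_sqrt hn'.le
    have h2 : √(n : ℝ) ≠ 0 := (Real.sqrt_pos.2 hn').ne'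
    calc β * c = β * c / (√(n : ℝ) * √n) * n := by rw [h1]; field_simp
      _ = _ := by field_simp
  · have h1 : Tendsto (fun n : ℕ => β ^ 2 * ((c / √(n : ℝ)) ^ 2 +
        ((∑ l ∈ Finset.range n, v l ^ 2) / n - ((∑ l ∈ Finset.range n, v l) / n) ^ 2)))
        atTop (𝓝 (β ^ 2 * (0 ^ 2 + (1 - 0 ^ 2)))) :=
      (((hc0 c).pow 2).add (hv2.sub (hv.pow 2))).const_mul _
    norm_num at h1
    refine h1.congr' ?_
    filter_upwards [eventually_ge_atTop 1] with n hn
    have hn' : (0 : ℝ) < n := by exact_mod_cast hn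
    simp only [recenter]
    set S := ∑ l ∈ Finset.range n, v l
    set d := c / √(n : ℝ)
    have hexp (l : ℕ) : (β / √(n : ℝ) * (d + (v l - S / n))) ^ 2 =
        β ^ 2 / n * ((d - S / n) ^ 2 + (2 * (d - S / n) * v l + v l ^ 2)) := by
      rw [mul_pow, div_pow, Real.sq_sqrt hn'.le]
      ring
    simp_rw [hexp]
    rw [← Finset.mul_sum, Finset.sum_add_distrib, Finset.sum_add_distrib, ← Finset.mul_sum]
    simp only [Finset.sum_const, Finset.card_range, nsmul_eq_mul]
    change _ = β ^ 2 / n * (n * (d - S / n) ^ 2 + (2 * (d - S / n) * S + _))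
    field_simp
    ring
  · intro ε hε
    by_cases hβ : β = 0
    · subst hβ; exact .of_forall fun n l _ => by simpa using hε
    have hβ' : 0 < |β| := abs_pos.2 hβ
    have hδ : 0 < ε / |β| / 3 := by positivity
    have h1 := (hc0 1).mul ((hc0 c).sub hv)
    filter_upwards [eventually_max_lt hv2 _ hδ,
      (Metric.tendsto_nhds.1 h1) _ hδ] with n h2 h3 l hl
    have h4 := h2 l hl
    rw [Real.dist_eq] at h3
    simp only [sub_zero, mul_zero] at h3
    have e : β / √(n : ℝ) * recenter c v n l = β * (v l / √(n : ℝ) +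
        1 / √(n : ℝ) * (c / √(n : ℝ) - (∑ m ∈ Finset.range n, v m) / n)) := by
      unfold recenter; ring
    rw [e, abs_mul, mul_comm, ← lt_div_iff₀ hβ']
    refine (abs_add_le _ _).trans_lt ?_
    linarith

/-! ### Coupling independent fields with a prescribed normalized sum -/

section Coupling

variable {ν : Measure (ℕ → ℝ)} {C : ℕ → ℕ → ℝ}

/-- The `n`-fold convolution power. -/
noncomputable def convPow (ν : Measure (ℕ → ℝ)) : ℕ → Measure (ℕ → ℝ)
  | 0 => Measure.dirac 0
  | n + 1 => convPow ν n ∗ ν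

theorem map_sum_eq_convPow {Ω ι : Type*} {mΩ : MeasurableSpace Ω} {μ : Measure Ω}
    [IsProbabilityMeasure μ] {X : ι → Ω → ℕ → ℝ} (hX : ∀ l, Measurable (X l))
    (hind : iIndepFun X μ) (hlaw : ∀ l, μ.map (X l) = ν) (s : Finset ι) :
    μ.map (∑ l ∈ s, X l) = convPow ν s.card := by
  classical
  induction s using Finset.induction with
  | empty =>
    rw [Finset.sum_empty, Finset.card_empty, convPow]
    exact (Measure.map_const μ (0 : ℕ → ℝ)).trans (by simp)
  | insert a s ha ih =>
    have hi : IndepFun (∑ l ∈ s, X l) (X a) μ := hind.indepFun_finsetSum_of_notMem hX ha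
    rw [Finset.sum_insert ha, Finset.card_insert_of_notMem ha, convPow, ← ih, ← hlaw a, add_comm,
      hi.map_add_eq_map_conv_map (by fun_prop) (hX a)]

/-- The law of a sequence of independent copies of a field with law `ν`. -/
noncomputable abbrev copies (ν : Measure (ℕ → ℝ)) [IsProbabilityMeasure ν] :
    Measure (ℕ → ℕ → ℝ) := Measure.infinitePi fun _ => ν

theorem measurePreserving_copies (ν : Measure (ℕ → ℝ)) [IsProbabilityMeasure ν] (l : ℕ) :
    MeasurePreserving (fun ω : ℕ → ℕ → ℝ => ω l) (copies ν) ν :=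
  measurePreserving_eval_infinitePi _ l

theorem iIndepFun_copies (ν : Measure (ℕ → ℝ)) [IsProbabilityMeasure ν] {E : Type*}
    [MeasurableSpace E] {f : (ℕ → ℝ) → E} (hf : Measurable f) :
    iIndepFun (fun l (ω : ℕ → ℕ → ℝ) => f (ω l)) (copies ν) :=
  iIndepFun_infinitePi (X := fun _ => f) fun _ => hf

variable [IsProbabilityMeasure ν]

theorem isGaussianProcess_copies (h : IsGaussianField ν C) :
    IsGaussianProcess (fun (p : ℕ × ℕ) (ω : ℕ → ℕ → ℝ) => ω p.1 p.2) (copies ν) where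
  hasGaussianLaw I := by
    classical
    let A := I.image Prod.fst
    let B := I.image Prod.snd
    have hind : iIndepFun (fun (l : A) (ω : ℕ → ℕ → ℝ) => B.restrict (ω l)) (copies ν) :=
      (iIndepFun_copies ν (f := B.restrict) (by fun_prop)).precomp Subtype.val_injective
    have hg : HasGaussianLaw (fun ω (l : A) => B.restrict (ω l)) (copies ν) := by
      refine iIndepFun.hasGaussianLaw (fun l => ⟨?_⟩) hind
      have := (h.1.hasGaussianLaw B).isGaussian_map
      rw [← (measurePreserving_copies ν l).map_eq, Measure.map_map (by fun_prop) (by fun_prop)]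
        at this
      exact this
    let L : (A → B → ℝ) →L[ℝ] (I → ℝ) := ContinuousLinearMap.pi fun p =>
      (ContinuousLinearMap.proj (R := ℝ) (φ := fun _ : B => ℝ)
        ⟨p.1.2, Finset.mem_image_of_mem _ p.2⟩).comp
        (ContinuousLinearMap.proj (R := ℝ) (φ := fun _ : A => B → ℝ)
        ⟨p.1.1, Finset.mem_image_of_mem _ p.2⟩)
    exact hg.map L

theorem memLp_copies (h : IsGaussianField ν C) (l i : ℕ) :
    MemLp (fun ω : ℕ → ℕ → ℝ => ω l i) 2 (copies ν) :=
  ((isGaussianProcess_copies h).hasGaussianLaw_eval (l, i)).memLp_two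

theorem integral_copies (h : IsGaussianField ν C) (l i : ℕ) :
    ∫ ω : ℕ → ℕ → ℝ, ω l i ∂(copies ν) = 0 := by
  have := h.2.1 i
  rwa [← (measurePreserving_copies ν l).map_eq, integral_map (measurable_pi_apply l).aemeasurable
    (measurable_pi_apply (X := fun _ : ℕ => ℝ) i).aestronglyMeasurable] at this

theorem integral_mul_copies (h : IsGaussianField ν C) (l m i j : ℕ) :
    ∫ ω : ℕ → ℕ → ℝ, ω l i * ω m j ∂(copies ν) = if l = m then C i j else 0 := by
  split_ifs with hlm
  · subst hlm
    have := h.2.2 i j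
    have hmul : Measurable fun κ : ℕ → ℝ => κ i * κ j := by fun_prop
    rwa [← (measurePreserving_copies ν l).map_eq, integral_map (measurable_pi_apply l).aemeasurable
      hmul.aestronglyMeasurable] at this
  · have hind := ((iIndepFun_copies ν measurable_id).indepFun hlm).comp
      (measurable_pi_apply i) (measurable_pi_apply j)
    have := hind.integral_fun_mul_eq_mul_integral (memLp_copies h l i).1 (memLp_copies h m j).1
    simpa [Function.comp, integral_copies h] using this

/-- Orthonormal combinations of independent copies of a centered Gaussian field are independent
copies of this field. -/
theorem iIndepFun_rotate (h : IsGaussianField ν C) {ι : Type*} (N : ℕ) (a : ι → ℕ → ℝ)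
    (ha : ∀ l m, ∑ k ∈ Finset.range N, a l k * a m k = Set.indicator {l} 1 m) :
    iIndepFun (fun l (ω : ℕ → ℕ → ℝ) i => ∑ k ∈ Finset.range N, a l k * ω k i) (copies ν) ∧
      ∀ l, (copies ν).map (fun ω i => ∑ k ∈ Finset.range N, a l k * ω k i) = ν := by
  have hmeas (l : ι) (i : ℕ) :
      Measurable fun ω : ℕ → ℕ → ℝ => ∑ k ∈ Finset.range N, a l k * ω k i := by fun_prop
  have hmem (l : ι) (i : ℕ) :
      MemLp (fun ω : ℕ → ℕ → ℝ => ∑ k ∈ Finset.range N, a l k * ω k i) 2 (copies ν) :=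
    memLp_finsetSum _ fun k _ => (memLp_copies h k i).const_mul _
  have hmean (l : ι) (i : ℕ) :
      ∫ ω : ℕ → ℕ → ℝ, ∑ k ∈ Finset.range N, a l k * ω k i ∂(copies ν) = 0 := by
    rw [integral_finsetSum _ fun k _ =>
      ((memLp_copies h k i).integrable (by norm_num)).const_mul _]
    simp [integral_const_mul, integral_copies h]
  have hmul (l m : ι) (i j : ℕ) : ∫ ω : ℕ → ℕ → ℝ, (∑ k ∈ Finset.range N, a l k * ω k i) *
      (∑ k ∈ Finset.range N, a m k * ω k j) ∂(copies ν) = Set.indicator {l} 1 m * C i j := by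
    have hint (k k' : ℕ) : Integrable (fun ω : ℕ → ℕ → ℝ => a l k * ω k i * (a m k' * ω k' j))
        (copies ν) :=
      ((memLp_copies h k i).const_mul _).integrable_mul ((memLp_copies h k' j).const_mul _)
    simp_rw [Finset.sum_mul_sum]
    rw [integral_finsetSum _ fun k _ => integrable_finsetSum _ fun k' _ => hint k k', ← ha,
      Finset.sum_mul]
    refine Finset.sum_congr rfl fun k hk => ?_
    rw [integral_finsetSum _ fun k' _ => hint k k']
    have hterm (k' : ℕ) : ∫ ω : ℕ → ℕ → ℝ, a l k * ω k i * (a m k' * ω k' j) ∂(copies ν) =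
        if k = k' then a l k * a m k * C i j else 0 := by
      have e (ω : ℕ → ℕ → ℝ) : a l k * ω k i * (a m k' * ω k' j) =
        a l k * a m k' * (ω k i * ω k' j) := by ring
      simp_rw [e]
      rw [integral_const_mul, integral_mul_copies h]
      split_ifs with hkk
      · rw [hkk]
      · rw [mul_zero]
    simp_rw [hterm]
    rw [Finset.sum_ite_eq, if_pos hk]
  have hgauss : IsGaussianProcess (fun (p : ι × ℕ) (ω : ℕ → ℕ → ℝ) =>
      ∑ k ∈ Finset.range N, a p.1 k * ω k p.2) (copies ν) := by
    refine IsGaussianProcess.of_isGaussianProcess (isGaussianProcess_copies h) fun p =>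
      ⟨(Finset.range N).map ⟨fun k => (k, p.2), fun _ _ h => (Prod.ext_iff.1 h).1⟩,
        ∑ k : Finset.range N, a p.1 k • ContinuousLinearMap.proj
          ⟨(k.1, p.2), Finset.mem_map.2 ⟨k.1, k.2, rfl⟩⟩, fun ω => ?_⟩
    simp only [sum_apply, smul_apply,
      ContinuousLinearMap.proj_apply, Finset.restrict, smul_eq_mul]
    rw [← Finset.sum_coe_sort]
  constructor
  · refine IsGaussianProcess.iIndepFun_of_covariance_eq_zero (S := fun _ => ℕ)
      (X := fun l i (ω : ℕ → ℕ → ℝ) => ∑ k ∈ Finset.range N, a l k * ω k i)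
      (hgauss.comp_right fun p : (_ : ι) × ℕ => (p.1, p.2))
      (fun l i => (hmeas l i).aemeasurable) fun l m hlm i j => ?_
    rw [covariance_eq_sub (hmem l i) (hmem m j)]
    have := hmul l m i j
    rw [Set.indicator_of_notMem (by simpa using hlm.symm), zero_mul] at this
    simp only [Pi.mul_apply]
    rw [this, hmean, zero_mul, sub_zero]
  · intro l
    refine IsGaussianField.unique (C := C) (isGaussianField_map (hmeas l)
      (hgauss.comp_right fun i => (l, i)) (hmean l) fun i j => ?_) h
    rw [hmul, Set.indicator_of_mem (by simp), Pi.one_apply, one_mul]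

/-- The `l`-th field of a family of `n` independent fields whose sum is `√n` times the field
`ω 0`. -/
noncomputable def coupled (n l : ℕ) (ω : ℕ → ℕ → ℝ) (i : ℕ) : ℝ :=
  recenter (ω 0 i) (fun m => ω (m + 1) i) n l

theorem measurable_coupled (n l : ℕ) : Measurable (coupled n l) := by
  unfold coupled recenter
  fun_prop

theorem iIndepFun_coupled (h : IsGaussianField ν C) {n : ℕ} (hn : n ≠ 0) :
    iIndepFun (fun l : Fin n => coupled n l) (copies ν) ∧
      ∀ l : Fin n, (copies ν).map (coupled n l) = ν := by
  -- Centering projects off the constant direction of ℝⁿ; the column 1/√n puts it back using the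
  -- field ω 0. Rows are orthonormal because 1/n + (δ_{lm} − 1/n) = δ_{lm}.
  let a (l : Fin n) (k : ℕ) : ℝ :=
    match k with
    | 0 => 1 / √n
    | k + 1 => (if (l : ℕ) = k then 1 else 0) - 1 / n
  have hn' : (n : ℝ) ≠ 0 := by exact_mod_cast hn
  have hn0 : (0 : ℝ) < n := by positivity
  have hcoup (l : Fin n) : coupled n l =
      fun ω i => ∑ k ∈ Finset.range (n + 1), a l k * ω k i := by
    funext ω i
    rw [Finset.sum_range_succ']
    simp only [a, sub_mul, Finset.sum_sub_distrib, ← Finset.mul_sum, ite_mul, one_mul, zero_mul,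
      Finset.sum_ite_eq, Finset.mem_range, l.2, if_true, coupled, recenter]
    ring
  have ha (l m : Fin n) : ∑ k ∈ Finset.range (n + 1), a l k * a m k =
      Set.indicator {l} 1 m := by
    rw [Finset.sum_range_succ']
    have h1 : 1 / √(n : ℝ) * (1 / √(n : ℝ)) = 1 / n := by
      rw [div_mul_div_comm, Real.mul_self_sqrt hn0.le, one_mul]
    simp only [a, h1, sub_mul, mul_sub, Finset.sum_sub_distrib, ite_mul, one_mul, zero_mul,
      Finset.sum_ite_eq, Finset.mem_range, l.2, if_true, mul_ite, mul_one, mul_zero, m.2,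
      Finset.sum_const, Finset.card_range, nsmul_eq_mul]
    by_cases hlm : m = l
    · subst hlm
      simp
      field_simp
      ring
    · have : (l : ℕ) ≠ m := fun h => hlm (Fin.ext h.symm)
      simp only [this, if_false, Set.mem_singleton_iff, hlm, not_false_eq_true,
        Set.indicator_of_notMem]
      field_simp
      ring
  simp_rw [hcoup]
  exact iIndepFun_rotate h (n + 1) a ha

/-- Strong law of large numbers for the coupled fields. -/
theorem ae_tendsto_sum_coupled (h : IsGaussianField ν C) (hC : ∀ i, C i i = 1) {f : ℝ → ℝ}
    {a b : ℝ} (hf : (fun u => f u - a * u - b * u ^ 2) =o[𝓝 0] fun u => u ^ 2) (β : ℝ) :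
    ∀ᵐ ω ∂(copies ν), ∀ i, Tendsto (fun n : ℕ => ∑ l ∈ Finset.range n,
      f (β / √n * coupled n l ω i)) atTop (𝓝 (a * (β * ω 0 i) + b * β ^ 2)) := by
  rw [ae_all_iff]
  intro i
  have hident (g : (ℕ → ℝ) → ℝ) (hg : Measurable g) (l : ℕ) :
      IdentDistrib (fun ω : ℕ → ℕ → ℝ => g (ω (l + 1))) (fun ω => g (ω (0 + 1)))
        (copies ν) (copies ν) := by
    have h0 : IdentDistrib (fun ω : ℕ → ℕ → ℝ => ω (l + 1)) (fun ω => ω (0 + 1))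
        (copies ν) (copies ν) :=
      ⟨(measurable_pi_apply _).aemeasurable, (measurable_pi_apply _).aemeasurable, by
        rw [(measurePreserving_copies ν _).map_eq, (measurePreserving_copies ν _).map_eq]⟩
    exact h0.comp hg
  have hpair (g : (ℕ → ℝ) → ℝ) (hg : Measurable g) :
      Pairwise (Function.onFun (fun X Y => IndepFun X Y (copies ν))
        fun (l : ℕ) (ω : ℕ → ℕ → ℝ) => g (ω (l + 1))) := fun l m hlm =>
    (iIndepFun_copies ν hg).indepFun (by simpa using hlm)
  have hsq : Measurable fun κ : ℕ → ℝ => κ i ^ 2 := by fun_prop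
  have h1 := strong_law_ae_real (fun (l : ℕ) (ω : ℕ → ℕ → ℝ) => ω (l + 1) i)
    ((memLp_copies h 1 i).integrable (by norm_num)) (hpair _ (measurable_pi_apply i))
    (hident _ (measurable_pi_apply i))
  have h2 := strong_law_ae_real (fun (l : ℕ) (ω : ℕ → ℕ → ℝ) => ω (l + 1) i ^ 2)
    (memLp_copies h 1 i).integrable_sq (hpair _ hsq) (hident _ hsq)
  have hvar : ∫ ω : ℕ → ℕ → ℝ, ω (0 + 1) i ^ 2 ∂(copies ν) = 1 := by
    simp_rw [sq]
    rw [integral_mul_copies h, if_pos rfl, hC]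
  rw [integral_copies h] at h1
  rw [hvar] at h2
  filter_upwards [h1, h2] with ω h1 h2
  exact tendsto_sum_recenter hf (ω 0 i) β h1 h2

end Coupling

/-! ### Exponential moments, summability and ties -/

section ExpMoments

variable {x : Space} {ν ν' : Measure (ℕ → ℝ)}

/-- By Tonelli the expected total mass is at most B ∑ ξ_i, which is finite. -/
theorem ae_summable_rawWeight (x : Space) {B : ENNReal} (hB : B ≠ ⊤)
    (h : ∀ i, ∫⁻ s, ENNReal.ofReal (Real.exp (s i)) ∂ν ≤ B) :
    ∀ᵐ s ∂ν, Summable (rawWeight id (x, s)) := by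
  have hm (i : ℕ) : Measurable fun s : ℕ → ℝ => ENNReal.ofReal (rawWeight id (x, s) i) := by
    simp only [rawWeight, id]; fun_prop
  have hnn (i : ℕ) : 0 ≤ x.weight i := x.2.2.1 i
  have hfin : ∫⁻ s, ∑' i, ENNReal.ofReal (rawWeight id (x, s) i) ∂ν ≠ ⊤ := by
    rw [lintegral_tsum fun i => (hm i).aemeasurable]
    refine ne_top_of_le_ne_top (b := ∑' i, ENNReal.ofReal (x.weight i) * B) ?_
      (ENNReal.tsum_le_tsum fun i => ?_)
    · rw [ENNReal.tsum_mul_right]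
      refine ENNReal.mul_ne_top ?_ hB
      rw [← ENNReal.ofReal_tsum_of_nonneg hnn x.2.2.2.1]
      exact ENNReal.ofReal_ne_top
    · simp only [rawWeight, id, ENNReal.ofReal_mul (hnn i)]
      rw [lintegral_const_mul _ (by fun_prop)]
      gcongr
      exact h i
  filter_upwards [ae_lt_top (Measurable.tsum hm) hfin] with s hs
  have := ENNReal.summable_toReal hs.ne
  refine this.congr fun i => ?_
  exact ENNReal.toReal_ofReal (mul_nonneg (hnn i) (Real.exp_pos _).le)

theorem lintegral_exp_conv [SFinite ν] [SFinite ν'] (i : ℕ) :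
    ∫⁻ s, ENNReal.ofReal (Real.exp (s i)) ∂(ν ∗ ν') =
      (∫⁻ s, ENNReal.ofReal (Real.exp (s i)) ∂ν) * ∫⁻ s, ENNReal.ofReal (Real.exp (s i)) ∂ν' := by
  rw [Measure.lintegral_conv (by fun_prop), ← lintegral_mul_const _ (by fun_prop)]
  refine lintegral_congr fun s => ?_
  rw [← lintegral_const_mul _ (by fun_prop)]
  refine lintegral_congr fun t => ?_
  rw [Pi.add_apply, Real.exp_add, ENNReal.ofReal_mul (Real.exp_pos _).le]

instance isProbabilityMeasure_convPow [IsProbabilityMeasure ν] (n : ℕ) :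
    IsProbabilityMeasure (convPow ν n) := by
  induction n with
  | zero => rw [convPow]; infer_instance
  | succ n ih => rw [convPow]; infer_instance

theorem lintegral_exp_convPow [IsProbabilityMeasure ν] (n i : ℕ) :
    ∫⁻ s, ENNReal.ofReal (Real.exp (s i)) ∂(convPow ν n) =
      (∫⁻ s, ENNReal.ofReal (Real.exp (s i)) ∂ν) ^ n := by
  induction n with
  | zero =>
    rw [convPow, lintegral_dirac' _ (by fun_prop)]
    simp
  | succ n ih => rw [convPow, lintegral_exp_conv, ih, pow_succ]

/-- After taking logarithms, a tie between i and j prescribes the value of t i - t j; there are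
countably many pairs. -/
theorem ae_injective_rawWeight (hx : ∀ i, 0 < x.weight i)
    (h : ∀ i j, i ≠ j → ∀ c, ∀ᵐ t ∂ν, t i - t j ≠ c) (s : ℕ → ℝ) :
    ∀ᵐ t ∂ν, Function.Injective (rawWeight id (x, s + t)) := by
  have h' : ∀ᵐ t ∂ν, ∀ i j, i ≠ j →
      t i - t j ≠ Real.log (x.weight j) + s j - (Real.log (x.weight i) + s i) := by
    simp only [ae_all_iff]
    exact fun i j hij => h i j hij _
  filter_upwards [h'] with t ht i j hij
  by_contra hne
  refine ht i j hne ?_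
  have := congrArg Real.log hij
  simp only [rawWeight, id, Pi.add_apply] at this
  rw [Real.log_mul (hx i).ne' (Real.exp_pos _).ne', Real.log_mul (hx j).ne' (Real.exp_pos _).ne',
    Real.log_exp, Real.log_exp] at this
  linarith

end ExpMoments

/-! ### Composition of evolutions -/

section Iterate

/-- The pointwise convolution of two kernels. -/
noncomputable def convKernel (A L : Kernel Space (ℕ → ℝ)) : Kernel Space (ℕ → ℝ) :=
  (A ×ₖ L).map fun p => p.1 + p.2

variable {A L : Kernel Space (ℕ → ℝ)} [IsMarkovKernel A] [IsMarkovKernel L]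
  {P : Measure Space} [IsProbabilityMeasure P]

instance : IsMarkovKernel (convKernel A L) :=
  Kernel.IsMarkovKernel.map _ (by fun_prop)

theorem convKernel_apply (x : Space) : convKernel A L x = A x ∗ L x := by
  rw [convKernel, Kernel.map_apply _ (by fun_prop), Kernel.prod_apply]
  rfl

theorem lintegral_map_evolve {f : (ℕ → ℝ) × (ℕ → ℕ → ℝ) → ENNReal} (hf : Measurable f)
    (A : Kernel Space (ℕ → ℝ)) [IsMarkovKernel A] :
    ∫⁻ z, f z ∂((P ⊗ₘ A).map (evolve id)) = ∫⁻ x, ∫⁻ s, f (evolve id (x, s)) ∂A x ∂P := by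
  rw [lintegral_map hf (measurable_evolve measurable_id)]
  exact Measure.lintegral_compProd (hf.comp (measurable_evolve measurable_id))

/-- Composition of two evolutions under which the law is invariant, when the second one is driven
by a field whose law depends on the overlaps only. -/
theorem map_evolve_convKernel (hpos : ∀ᵐ x ∂P, ∀ i, 0 < x.weight i)
    (hA : ∀ᵐ x ∂P, ∀ᵐ s ∂A x, Summable (rawWeight id (x, s)))
    (hAL : ∀ᵐ x ∂P, ∀ᵐ s ∂A x, ∀ᵐ t ∂L x,
      Summable (rawWeight id (x, s + t)) ∧ Function.Injective (rawWeight id (x, s + t)))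
    (hequiv : ∀ (x y : Space) (σ : ℕ → ℕ),
      (∀ m n, y.overlap m n = x.overlap (σ m) (σ n)) → L y = (L x).map fun t => t ∘ σ)
    (hqA : (P ⊗ₘ A).map (evolve id) = P.map Subtype.val)
    (hqL : (P ⊗ₘ L).map (evolve id) = P.map Subtype.val) :
    (P ⊗ₘ convKernel A L).map (evolve id) = P.map Subtype.val := by
  have hev := measurable_evolve measurable_id
  refine Measure.ext_of_lintegral _ fun f hf => ?_
  have hF : Measurable fun y : Space => ∫⁻ t, f (evolve id (y, t)) ∂L y :=
    (hf.comp hev).lintegral_kernel_prod_right'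
  -- Quasi-stationarity equates measures on the ambient product, so the second-step expectation is
  -- extended off the configuration space.
  obtain ⟨F, hFm, hFe⟩ := measurableEmbedding_val.exists_measurable_extend hF fun y => ⟨0⟩
  have hFe' (y : Space) : F y.1 = ∫⁻ t, f (evolve id (y, t)) ∂L y := congrFun hFe y
  calc ∫⁻ z, f z ∂((P ⊗ₘ convKernel A L).map (evolve id))
      = ∫⁻ x, ∫⁻ s, ∫⁻ t, f (evolve id (x, s + t)) ∂L x ∂A x ∂P := by
        rw [lintegral_map_evolve hf]
        refine lintegral_congr fun x => ?_
        rw [convKernel_apply, Measure.lintegral_conv]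
        exact hf.comp (hev.comp measurable_prodMk_left)
    _ = ∫⁻ x, ∫⁻ s, F (evolve id (x, s)) ∂A x ∂P := by
        refine lintegral_congr_ae ?_
        filter_upwards [hpos, hA, hAL] with x hx hxA hxAL
        refine lintegral_congr_ae ?_
        filter_upwards [hxA, hxAL] with s hs hst
        let y : Space := ⟨evolve id (x, s), evolve_mem_configs hx hs⟩
        change _ = F y.1
        -- In the original labels, the field driving the second step has law `L x`, whatever
        -- permutation the first step produced.
        rw [hFe', hequiv x y (sortIndex (rawWeight id (x, s))) fun m n => rfl]
        refine Eq.trans ?_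
          (lintegral_map (hf.comp (hev.comp measurable_prodMk_left)) (by fun_prop)).symm
        refine lintegral_congr_ae ?_
        filter_upwards [hst] with t ht
        exact congrArg f (evolve_evolve hx hs ht.1 ht.2 rfl).symm
    _ = ∫⁻ z, F z ∂((P ⊗ₘ A).map (evolve id)) := (lintegral_map_evolve hFm A).symm
    _ = ∫⁻ z, F z ∂(P.map Subtype.val) := by rw [hqA]
    _ = ∫⁻ y, ∫⁻ t, f (evolve id (y, t)) ∂L y ∂P := by
        rw [lintegral_map hFm measurable_subtype_coe]
        exact lintegral_congr hFe'
    _ = ∫⁻ z, f z ∂(P.map Subtype.val) := by rw [← lintegral_map_evolve hf, hqL]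

/-- The convolution powers of a kernel, starting with the kernel itself. -/
noncomputable def powKernel (L : Kernel Space (ℕ → ℝ)) : ℕ → Kernel Space (ℕ → ℝ)
  | 0 => L
  | n + 1 => convKernel (powKernel L n) L

instance (n : ℕ) : IsMarkovKernel (powKernel L n) := by
  induction n with
  | zero => rw [powKernel]; infer_instance
  | succ n ih => rw [powKernel]; infer_instance

/-- The shift makes the base case of the iteration the hypothesis on `L`; zero factors would give
the bare normalization map. -/
theorem powKernel_apply (n : ℕ) (x : Space) : powKernel L n x = convPow (L x) (n + 1) := by
  induction n with
  | zero => rw [powKernel, convPow, convPow, Measure.dirac_zero_conv]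
  | succ n ih => rw [powKernel, convKernel_apply, ih]; rfl

/-- Induction on the number of steps: exponential moments multiply, which keeps the masses finite,
and the last factor alone excludes ties. -/
theorem map_evolve_powKernel (hpos : ∀ᵐ x ∂P, ∀ i, 0 < x.weight i) {B : ENNReal} (hB : B ≠ ⊤)
    (hmom : ∀ x i, ∫⁻ t, ENNReal.ofReal (Real.exp (t i)) ∂L x ≤ B)
    (hties : ∀ᵐ x ∂P, ∀ i j, i ≠ j → ∀ c, ∀ᵐ t ∂L x, t i - t j ≠ c)
    (hequiv : ∀ (x y : Space) (σ : ℕ → ℕ),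
      (∀ m n, y.overlap m n = x.overlap (σ m) (σ n)) → L y = (L x).map fun t => t ∘ σ)
    (hqL : (P ⊗ₘ L).map (evolve id) = P.map Subtype.val) (n : ℕ) :
    (P ⊗ₘ powKernel L n).map (evolve id) = P.map Subtype.val := by
  have hsum (n : ℕ) (x : Space) : ∀ᵐ s ∂powKernel L n x, Summable (rawWeight id (x, s)) := by
    refine ae_summable_rawWeight x (ENNReal.pow_ne_top (n := n + 1) hB) fun i => ?_
    rw [powKernel_apply, lintegral_exp_convPow]
    gcongr
    exact hmom x i
  induction n with
  | zero => exact hqL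
  | succ n ih =>
    refine map_evolve_convKernel hpos (.of_forall (hsum n)) ?_ hequiv ih hqL
    filter_upwards [hpos, hties] with x hx hxt
    have h2 : ∀ᵐ s ∂powKernel L n x, ∀ᵐ t ∂L x, Summable (rawWeight id (x, s + t)) := by
      have := hsum (n + 1) x
      rw [powKernel, convKernel_apply, Measure.conv] at this
      exact Measure.ae_ae_of_ae_prod (ae_of_ae_map (by fun_prop) this)
    filter_upwards [h2] with s hs
    filter_upwards [hs, ae_injective_rawWeight hx hxt s] with t h3 h4
    exact ⟨h3, h4⟩

end Iterate

/-! ### Passing to the limit in the evolution -/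

section Limit

variable {Ω : Type*} {mΩ : MeasurableSpace Ω} {μ : Measure Ω}

/-- Convergence of the total mass to zero implies almost sure convergence along a subsequence. -/
theorem exists_subseq_ae_tendsto_zero {D : ℕ → Ω → ENNReal} (hD : ∀ n, Measurable (D n))
    (hfin : ∀ n, ∀ᵐ ω ∂μ, D n ω ≠ ⊤) (h : Tendsto (fun n => ∫⁻ ω, D n ω ∂μ) atTop (𝓝 0)) :
    ∃ ms : ℕ → ℕ, StrictMono ms ∧ ∀ᵐ ω ∂μ, Tendsto (fun k => D (ms k) ω) atTop (𝓝 0) := by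
  have hm : TendstoInMeasure μ (fun n ω => (D n ω).toReal) atTop fun _ => (0 : ℝ) := by
    refine tendstoInMeasure_of_tendsto_eLpNorm one_ne_zero
      (fun n => (hD n).ennreal_toReal.aestronglyMeasurable) aestronglyMeasurable_const ?_
    refine tendsto_of_tendsto_of_tendsto_of_le_of_le tendsto_const_nhds h (fun _ => zero_le)
      fun n => ?_
    rw [eLpNorm_one_eq_lintegral_enorm]
    refine lintegral_mono fun ω => ?_
    simp only [Pi.sub_apply, sub_zero]
    rw [Real.enorm_of_nonneg ENNReal.toReal_nonneg]
    exact ENNReal.ofReal_toReal_le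
  obtain ⟨ms, hms, hlim⟩ := hm.exists_seq_tendsto_ae
  refine ⟨ms, hms, ?_⟩
  filter_upwards [hlim, ae_all_iff.2 hfin] with ω h1 h2
  have h3 := ENNReal.tendsto_ofReal h1
  rw [ENNReal.ofReal_zero] at h3
  exact h3.congr fun k => ENNReal.ofReal_toReal (h2 _)

variable [IsProbabilityMeasure μ] {x : Space} {U : ℕ → Ω → ℕ → ℝ} {S : Ω → ℕ → ℝ}

/-- Continuity of the evolution needs ℓ¹ convergence of the weights. The truncated distances tend to
zero in mean at each site, with the summable bound ξ_i (B + B), so their sum over sites tends to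
zero in mean and almost surely along a subsequence. -/
theorem exists_subseq_tendsto_evolve (hx : ∀ i, 0 < x.weight i)
    (hU : ∀ n, Measurable (U n)) (hS : Measurable S)
    (hlim : ∀ᵐ ω ∂μ, ∀ i, Tendsto (fun n => U n ω i) atTop (𝓝 (S ω i)))
    {B : ENNReal} (hB : B ≠ ⊤) (hmom : ∀ n i, ∫⁻ ω, ENNReal.ofReal (Real.exp (U n ω i)) ∂μ ≤ B)
    (hinj : ∀ᵐ ω ∂μ, Function.Injective (rawWeight id (x, S ω))) :
    ∃ ms : ℕ → ℕ, StrictMono ms ∧ ∀ᵐ ω ∂μ,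
      Tendsto (fun k => evolve id (x, U (ms k) ω)) atTop (𝓝 (evolve id (x, S ω))) := by
  have hnn (i : ℕ) : 0 ≤ x.weight i := (hx i).le
  -- Fatou's lemma.
  have hmomS (i : ℕ) : ∫⁻ ω, ENNReal.ofReal (Real.exp (S ω i)) ∂μ ≤ B := by
    calc ∫⁻ ω, ENNReal.ofReal (Real.exp (S ω i)) ∂μ
        = ∫⁻ ω, liminf (fun n => ENNReal.ofReal (Real.exp (U n ω i))) atTop ∂μ := by
          refine lintegral_congr_ae ?_
          filter_upwards [hlim] with ω hω
          exact (ENNReal.tendsto_ofReal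
            ((Real.continuous_exp.tendsto _).comp (hω i))).liminf_eq.symm
      _ ≤ liminf (fun n => ∫⁻ ω, ENNReal.ofReal (Real.exp (U n ω i)) ∂μ) atTop :=
          lintegral_liminf_le fun n => by fun_prop
      _ ≤ B := liminf_le_of_le (by isBoundedDefault) fun b hb => by
          obtain ⟨n, hn⟩ := hb.exists
          exact hn.trans (hmom n i)
  have hsumm {V : Ω → ℕ → ℝ} (hV : Measurable V)
      (h : ∀ i, ∫⁻ ω, ENNReal.ofReal (Real.exp (V ω i)) ∂μ ≤ B) :
      ∀ᵐ ω ∂μ, Summable (rawWeight id (x, V ω)) := by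
    refine ae_of_ae_map hV.aemeasurable (ae_summable_rawWeight x hB fun i => ?_)
    rw [lintegral_map (by fun_prop) hV]
    exact h i
  have hsU (n : ℕ) := hsumm (hU n) (hmom n)
  have hsS := hsumm hS hmomS
  have hmeas {V : Ω → ℕ → ℝ} (hV : Measurable V) (i : ℕ) :
      Measurable fun ω => rawWeight id (x, V ω) i := by
    simp only [rawWeight, id]; fun_prop
  let d (n i : ℕ) (ω : Ω) : ℝ := |rawWeight id (x, U n ω) i - rawWeight id (x, S ω) i|
  have hdm (n i : ℕ) : Measurable (d n i) := ((hmeas (hU n) i).sub (hmeas hS i)).abs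
  have hdnn (n i : ℕ) (ω : Ω) : 0 ≤ d n i ω := abs_nonneg _
  -- The truncation at 1 allows dominated convergence in ω, since a bound on the means of the
  -- exponentials gives no uniform integrability.
  have hmin (n i : ℕ) : Measurable fun ω => ENNReal.ofReal (min 1 (d n i ω)) :=
    (measurable_const.min (hdm n i)).ennreal_ofReal
  have hterm (i : ℕ) :
      Tendsto (fun n => ∫⁻ ω, ENNReal.ofReal (min 1 (d n i ω)) ∂μ) atTop (𝓝 0) := by
    rw [← lintegral_zero (μ := μ)]
    refine tendsto_lintegral_of_dominated_convergence (fun _ => 1) (hmin · i)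
      (fun n => .of_forall fun ω => ?_) (by simp) ?_
    · exact ENNReal.ofReal_le_one.2 (min_le_left _ _)
    · filter_upwards [hlim] with ω hω
      have h1 : Tendsto (fun n => d n i ω) atTop (𝓝 0) := by
        have h2 : Tendsto (fun n => rawWeight id (x, U n ω) i) atTop
            (𝓝 (rawWeight id (x, S ω) i)) :=
          ((Real.continuous_exp.tendsto _).comp (hω i)).const_mul _
        simpa using (h2.sub_const (rawWeight id (x, S ω) i)).abs
      simpa using ENNReal.tendsto_ofReal ((tendsto_const_nhds (x := (1 : ℝ))).min h1)
  have hbound (n i : ℕ) : ∫⁻ ω, ENNReal.ofReal (min 1 (d n i ω)) ∂μ ≤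
      ENNReal.ofReal (x.weight i) * (B + B) := by
    calc ∫⁻ ω, ENNReal.ofReal (min 1 (d n i ω)) ∂μ
        ≤ ∫⁻ ω, ENNReal.ofReal (x.weight i) * (ENNReal.ofReal (Real.exp (U n ω i)) +
            ENNReal.ofReal (Real.exp (S ω i))) ∂μ := by
          refine lintegral_mono fun ω => ?_
          rw [← ENNReal.ofReal_add (Real.exp_pos _).le (Real.exp_pos _).le,
            ← ENNReal.ofReal_mul (hnn i)]
          refine ENNReal.ofReal_le_ofReal ((min_le_right _ _).trans ?_)
          refine (abs_sub _ _).trans_eq ?_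
          rw [abs_of_pos (rawWeight_pos hx _ i), abs_of_pos (rawWeight_pos hx _ i), mul_add]
          rfl
      _ = ENNReal.ofReal (x.weight i) * (∫⁻ ω, ENNReal.ofReal (Real.exp (U n ω i)) ∂μ +
            ∫⁻ ω, ENNReal.ofReal (Real.exp (S ω i)) ∂μ) := by
          rw [lintegral_const_mul _ (by fun_prop), lintegral_add_left (by fun_prop)]
      _ ≤ _ := by
          gcongr
          · exact hmom n i
          · exact hmomS i
  have hBsum : ∑' i, ENNReal.ofReal (x.weight i) * (B + B) ≠ ⊤ := by
    rw [ENNReal.tsum_mul_right, ← ENNReal.ofReal_tsum_of_nonneg hnn x.2.2.2.1]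
    exact ENNReal.mul_ne_top ENNReal.ofReal_ne_top (ENNReal.add_ne_top.2 ⟨hB, hB⟩)
  let D (n : ℕ) (ω : Ω) : ENNReal := ∑' i, ENNReal.ofReal (min 1 (d n i ω))
  have hDm (n : ℕ) : Measurable (D n) := Measurable.tsum (hmin n)
  have hDint (n : ℕ) : ∫⁻ ω, D n ω ∂μ = ∑' i, ∫⁻ ω, ENNReal.ofReal (min 1 (d n i ω)) ∂μ :=
    lintegral_tsum fun i => (hmin n i).aemeasurable
  have hDfin (n : ℕ) : ∀ᵐ ω ∂μ, D n ω ≠ ⊤ := by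
    have : ∫⁻ ω, D n ω ∂μ ≠ ⊤ := by
      rw [hDint]
      exact ne_top_of_le_ne_top hBsum (ENNReal.tsum_le_tsum fun i => hbound n i)
    filter_upwards [ae_lt_top (hDm n) this] with ω hω using hω.ne
  have hDlim : Tendsto (fun n => ∫⁻ ω, D n ω ∂μ) atTop (𝓝 0) := by
    simp_rw [hDint, ← lintegral_count]
    rw [← lintegral_zero (μ := (Measure.count : Measure ℕ))]
    refine tendsto_lintegral_of_dominated_convergence
      (fun i => ENNReal.ofReal (x.weight i) * (B + B)) (fun n => .of_discrete)
      (fun n => .of_forall fun i => hbound n i) ?_ (.of_forall hterm)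
    rwa [lintegral_count]
  obtain ⟨ms, hms, hae⟩ := exists_subseq_ae_tendsto_zero hDm hDfin hDlim
  refine ⟨ms, hms, ?_⟩
  filter_upwards [hae, ae_all_iff.2 hsU, hsS, hinj] with ω h1 h2 h3 h4
  refine tendsto_evolve hx h3 h4 (fun k => h2 (ms k)) ?_
  have hsum (n : ℕ) : Summable fun i => d n i ω := ((h2 n).sub h3).abs
  -- Once the truncated sum is below 1 no term is truncated, so it equals the genuine ℓ¹ distance.
  have h5 : ∀ᶠ k in atTop, D (ms k) ω < 1 := h1.eventually (gt_mem_nhds one_pos)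
  have h6 : ∀ᶠ k in atTop, (D (ms k) ω).toReal = ∑' i, d (ms k) i ω := by
    filter_upwards [h5] with k hk
    have hlt (i : ℕ) : min 1 (d (ms k) i ω) = d (ms k) i ω := by
      refine min_eq_right (le_of_not_gt fun hgt => hk.not_ge ?_)
      have := ENNReal.le_tsum (f := fun i => ENNReal.ofReal (min 1 (d (ms k) i ω))) i
      rwa [min_eq_left hgt.le, ENNReal.ofReal_one] at this
    simp only [D, hlt]
    rw [← ENNReal.ofReal_tsum_of_nonneg (fun i => hdnn _ i ω) (hsum _),
      ENNReal.toReal_ofReal (tsum_nonneg fun i => hdnn _ i ω)]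
  have h7 : Tendsto (fun k => (D (ms k) ω).toReal) atTop (𝓝 0) := by
    have := (ENNReal.tendsto_toReal ENNReal.zero_ne_top).comp h1
    rwa [ENNReal.toReal_zero] at this
  exact h7.congr' h6

theorem measurable_evolve_comp (x : Space) {V : Ω → ℕ → ℝ} (hV : Measurable V) :
    Measurable fun ω => evolve id (x, V ω) :=
  (measurable_evolve measurable_id).comp (measurable_const.prodMk hV)

/-- Almost sure convergence holds along subsequences only, but every subsequence has a further one
with the same limit. -/
theorem tendsto_integral_evolve (hx : ∀ i, 0 < x.weight i)
    (hU : ∀ n, Measurable (U n)) (hS : Measurable S)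
    (hlim : ∀ᵐ ω ∂μ, ∀ i, Tendsto (fun n => U n ω i) atTop (𝓝 (S ω i)))
    {B : ENNReal} (hB : B ≠ ⊤) (hmom : ∀ n i, ∫⁻ ω, ENNReal.ofReal (Real.exp (U n ω i)) ∂μ ≤ B)
    (hinj : ∀ᵐ ω ∂μ, Function.Injective (rawWeight id (x, S ω)))
    (f : BoundedContinuousFunction ((ℕ → ℝ) × (ℕ → ℕ → ℝ)) ℝ) :
    Tendsto (fun n => ∫ ω, f (evolve id (x, U n ω)) ∂μ) atTop
      (𝓝 (∫ ω, f (evolve id (x, S ω)) ∂μ)) := by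
  refine tendsto_of_subseq_tendsto fun ns hns => ?_
  obtain ⟨ms, hms, hae⟩ := exists_subseq_tendsto_evolve hx (fun n => hU (ns n)) hS
    (hlim.mono fun ω h i => (h i).comp hns) hB (fun n => hmom (ns n)) hinj
  refine ⟨ms, tendsto_integral_of_dominated_convergence (fun _ => ‖f‖) (fun k => ?_)
    (integrable_const _) (fun k => .of_forall fun ω => f.norm_coe_le_norm _) ?_⟩
  · exact (f.continuous.measurable.comp
      (measurable_evolve_comp x (hU _))).aestronglyMeasurable
  · exact hae.mono fun ω h => (f.continuous.tendsto _).comp h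

end Limit

/-! ### Many small nonlinear steps approximate a linear one -/

section Increments

/-- The increments `ψ (a κ_i + h) - ψ h` of a field. -/
noncomputable def increments (ψ : ℝ → ℝ) (h a : ℝ) (κ : ℕ → ℝ) (i : ℕ) : ℝ :=
  ψ (a * κ i + h) - ψ h

variable {ψ : ℝ → ℝ} {ν : Measure (ℕ → ℝ)} {C : ℕ → ℕ → ℝ}

theorem measurable_increments (hψ : Admissible ψ) (h a : ℝ) : Measurable (increments ψ h a) := by
  have := hψ.measurable
  unfold increments
  fun_prop

theorem lintegral_exp_increments (hψ : Admissible ψ) (hν : IsGaussianField ν C)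
    (hC : ∀ i, C i i = 1) (h a : ℝ) (i : ℕ) :
    ∫⁻ t, ENNReal.ofReal (Real.exp (t i)) ∂(ν.map (increments ψ h a)) =
      ∫⁻ y, ENNReal.ofReal (Real.exp (ψ (a * y + h) - ψ h)) ∂(gaussianReal 0 1) := by
  have := hψ.measurable
  rw [lintegral_map (by fun_prop) (measurable_increments hψ h a), ← hν.map_eval (hC i),
    lintegral_map (by fun_prop) (measurable_pi_apply i)]
  rfl

theorem ae_map_sub_ne {F : (ℕ → ℝ) → ℕ → ℝ} (hF : Measurable F) {i j : ℕ} {c : ℝ}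
    (h : ∀ᵐ κ ∂ν, F κ i - F κ j ≠ c) : ∀ᵐ t ∂(ν.map F), t i - t j ≠ c := by
  have hset : MeasurableSet {t : ℕ → ℝ | t i - t j = c} :=
    measurableSet_eq_fun ((measurable_pi_apply i).sub (measurable_pi_apply j)) measurable_const
  exact (ae_map_iff hF.aemeasurable hset.compl).2 h

theorem ae_increments_sub_ne (hψ : Admissible ψ) (hν : IsGaussianField ν C)
    (hC : ∀ i, C i i = 1) (h : ℝ) {a : ℝ} (ha : a ≠ 0) {i j : ℕ} (hij : |C i j| < 1) (c : ℝ) :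
    ∀ᵐ t ∂(ν.map (increments ψ h a)), t i - t j ≠ c := by
  have hm := hψ.measurable
  refine ae_map_sub_ne (measurable_increments hψ h a) ?_
  exact ae_sub_ne hν (f := fun y => ψ (a * y + h) - ψ h) (by fun_prop)
    (hψ.volume_level_affine ha h (ψ h)) (hC i) (hC j) hij c

/-- Many small independent evolutions are asymptotically equivalent to a linear one. -/
theorem tendsto_integral_convPow (hψ : Admissible ψ) (hν : IsGaussianField ν C)
    [IsProbabilityMeasure ν] (hC : ∀ i, C i i = 1) (hlt : ∀ i j, i ≠ j → |C i j| < 1) {h : ℝ}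
    (hh : deriv ψ h ≠ 0) {β : ℝ} (hβ : β ≠ 0) {x : Space} (hx : ∀ i, 0 < x.weight i)
    (f : BoundedContinuousFunction ((ℕ → ℝ) × (ℕ → ℕ → ℝ)) ℝ) :
    Tendsto (fun n : ℕ => ∫ s, f (evolve id (x, s))
        ∂(convPow (ν.map (increments ψ h (β / √(n + 1 : ℕ)))) (n + 1))) atTop
      (𝓝 (∫ κ, f (evolve (fun y => deriv ψ h * β * y) (x, κ)) ∂ν)) := by
  have hinc (a : ℝ) := measurable_increments hψ h a
  let U (n : ℕ) : (ℕ → ℕ → ℝ) → ℕ → ℝ :=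
    ∑ l : Fin (n + 1), fun ω => increments ψ h (β / √(n + 1 : ℕ)) (coupled (n + 1) l ω)
  let b := deriv (deriv ψ) h / 2
  -- The shift b β² does not depend on i, because all sites have variance 1.
  let S (ω : ℕ → ℕ → ℝ) (i : ℕ) : ℝ := deriv ψ h * (β * ω 0 i) + b * β ^ 2
  have hcm (n l : ℕ) : Measurable fun ω =>
      increments ψ h (β / √(n + 1 : ℕ)) (coupled (n + 1) l ω) :=
    (hinc _).comp (measurable_coupled _ l)
  have hUm (n : ℕ) : Measurable (U n) := by
    convert Finset.measurable_sum Finset.univ fun (l : Fin (n + 1)) _ => hcm n l using 1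
    funext ω
    simp only [U, Finset.sum_apply]
  have hSm : Measurable S := by
    simp only [S]
    fun_prop
  have hUlaw (n : ℕ) : (copies ν).map (U n) =
      convPow (ν.map (increments ψ h (β / √(n + 1 : ℕ)))) (n + 1) := by
    obtain ⟨hind, hlaw⟩ := iIndepFun_coupled hν (Nat.succ_ne_zero n)
    have hlaw' (l : Fin (n + 1)) : (copies ν).map (fun ω =>
        increments ψ h (β / √(n + 1 : ℕ)) (coupled (n + 1) l ω)) =
        ν.map (increments ψ h (β / √(n + 1 : ℕ))) := by
      have := Measure.map_map (μ := copies ν) (hinc (β / √(n + 1 : ℕ)))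
        (measurable_coupled (n + 1) l)
      rw [hlaw l] at this
      exact this.symm
    have := map_sum_eq_convPow (fun l : Fin (n + 1) => hcm n l)
      (hind.comp (fun _ => increments ψ h (β / √(n + 1 : ℕ))) fun _ => hinc _) hlaw' Finset.univ
    rwa [Finset.card_univ, Fintype.card_fin] at this
  have hprob (a : ℝ) : IsProbabilityMeasure (ν.map (increments ψ h a)) :=
    Measure.isProbabilityMeasure_map (hinc a).aemeasurable
  obtain ⟨A, hA⟩ := hψ.exists_lintegral_exp_le h |β|
  have hmom (n i : ℕ) : ∫⁻ ω, ENNReal.ofReal (Real.exp (U n ω i)) ∂(copies ν) ≤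
      ENNReal.ofReal (Real.exp (A * β ^ 2)) := by
    have hn : (0 : ℝ) < (n + 1 : ℕ) := by positivity
    have h1 : |β / √(n + 1 : ℕ)| ≤ |β| := by
      rw [abs_div, abs_of_nonneg (Real.sqrt_nonneg _)]
      refine div_le_self (abs_nonneg _) (Real.one_le_sqrt.2 ?_)
      exact_mod_cast Nat.succ_pos n
    have h2 := lintegral_map (μ := copies ν)
      (f := fun s : ℕ → ℝ => ENNReal.ofReal (Real.exp (s i))) (by fun_prop) (hUm n)
    rw [← h2, hUlaw, lintegral_exp_convPow, lintegral_exp_increments hψ hν hC]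
    -- exp(A β²/(n+1)) to the power n + 1 is exp(A β²), uniformly in n.
    refine (pow_le_pow_left' (hA _ h1) _).trans_eq ?_
    rw [← ENNReal.ofReal_pow (Real.exp_pos _).le, ← Real.exp_nat_mul, div_pow,
      Real.sq_sqrt hn.le]
    congr 2
    field_simp
  have hlim : ∀ᵐ ω ∂(copies ν), ∀ i, Tendsto (fun n => U n ω i) atTop (𝓝 (S ω i)) := by
    filter_upwards [ae_tendsto_sum_coupled hν hC (hψ.taylor_isLittleO h) β] with ω hω i
    refine ((hω i).comp (tendsto_add_atTop_nat 1)).congr fun n => ?_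
    simp only [U, Finset.sum_apply, Function.comp]
    rw [Finset.sum_range]
    rfl
  have hmm : Measurable fun (κ : ℕ → ℝ) i => deriv ψ h * β * κ i := by fun_prop
  have hinj : ∀ᵐ ω ∂(copies ν), Function.Injective (rawWeight id (x, S ω)) := by
    have h1 := ae_injective_rawWeight (ν := ν.map fun κ i => deriv ψ h * β * κ i) hx
      (fun i j hij c => ?_) fun _ => b * β ^ 2
    · rw [← (measurePreserving_copies ν 0).map_eq, Measure.map_map hmm
        (measurable_pi_apply 0)] at h1
      filter_upwards [ae_of_ae_map (hmm.comp (measurable_pi_apply 0)).aemeasurable h1] with ω hω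
      convert hω using 3
      funext i
      simp only [S, Pi.add_apply, Function.comp]
      ring
    · refine ae_map_sub_ne hmm ?_
      refine ae_sub_ne hν (f := fun y => deriv ψ h * β * y) (by fun_prop) (fun c => ?_) (hC i)
        (hC j) (hlt i j hij) c
      refine Set.Subsingleton.measure_zero (fun y hy z hz => ?_) _
      exact mul_left_cancel₀ (mul_ne_zero hh hβ) ((Set.mem_ofPred_eq ▸ hy).trans hz.symm)
  have key := tendsto_integral_evolve hx hUm hSm hlim ENNReal.ofReal_ne_top hmom hinj f
  have hfm : Measurable fun s => f (evolve id (x, s)) :=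
    f.continuous.measurable.comp (measurable_evolve_comp x measurable_id)
  have hend : ∫ ω, f (evolve id (x, S ω)) ∂(copies ν) =
      ∫ κ, f (evolve (fun y => deriv ψ h * β * y) (x, κ)) ∂ν := by
    have hme : Measurable fun κ => f (evolve (fun y => deriv ψ h * β * y) (x, κ)) :=
      hfm.comp (g := fun s => f (evolve id (x, s)))
        (f := fun (κ : ℕ → ℝ) i => deriv ψ h * β * κ i) hmm
    conv_rhs => rw [← (measurePreserving_copies ν 0).map_eq]
    rw [integral_map (measurable_pi_apply 0).aemeasurable hme.aestronglyMeasurable]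
    refine integral_congr_ae (.of_forall fun ω => ?_)
    simp only [S]
    rw [evolve_add_const]
    change _ = f (evolve id (x, fun i => deriv ψ h * β * ω 0 i))
    simp only [mul_assoc]
  rw [hend] at key
  refine key.congr fun n => ?_
  rw [← hUlaw, integral_map (hUm n).aemeasurable hfm.aestronglyMeasurable]

end Increments

/-! ### From invariance under ψ to invariance under linear functions -/

section QuasiStationary

/-- The conditional law of the Gaussian field can be fixed beforehand. -/
theorem QuasiStationary.map_evolve_eq {r : ℕ} {P : Measure Space}
    {K : Kernel Space (ℕ → ℝ)} (hK : ∀ x, IsGaussianField (K x) fun i j => x.overlap i j ^ r)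
    {ψ : ℝ → ℝ} (h : QuasiStationary r ψ P) : (P ⊗ₘ K).map (evolve ψ) = P.map Subtype.val := by
  obtain ⟨K', _, hK', h'⟩ := h
  rwa [show K = K' from Kernel.ext fun x => (hK x).unique (hK' x)]

variable {r : ℕ} {ψ : ℝ → ℝ} {P : Measure Space} [IsProbabilityMeasure P]
  {K : Kernel Space (ℕ → ℝ)} [IsMarkovKernel K]

/-- Moving the nonlinearity into the kernel turns iterated evolutions into convolutions of kernels.
-/
theorem map_evolve_map {g : ℝ → ℝ} (hg : Measurable g) :
    (P ⊗ₘ K.map fun κ i => g (κ i)).map (evolve id) = (P ⊗ₘ K).map (evolve g) := by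
  have hgm : Measurable fun (κ : ℕ → ℝ) i => g (κ i) := by fun_prop
  have : IsMarkovKernel (K.map fun κ i => g (κ i)) := Kernel.IsMarkovKernel.map _ hgm
  refine Measure.ext_of_lintegral _ fun f hf => ?_
  rw [lintegral_map_evolve hf, lintegral_map hf (measurable_evolve hg)]
  refine Eq.trans ?_ (Measure.lintegral_compProd (hf.comp (measurable_evolve hg))).symm
  refine lintegral_congr fun x => ?_
  rw [Kernel.map_apply _ hgm]
  exact lintegral_map (hf.comp (measurable_evolve_comp x measurable_id)) hgm

theorem evolve_sub_const (g : ℝ → ℝ) (c : ℝ) : evolve (fun y => g y - c) = evolve g := by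
  funext ⟨x, κ⟩
  exact evolve_add_const x (fun i => g (κ i)) (-c)

/-- A centered Gaussian field and its opposite have the same law. -/
theorem QuasiStationary.neg {l : ℝ} (h : QuasiStationary r (fun y => l * y) P) :
    QuasiStationary r (fun y => -l * y) P := by
  obtain ⟨K, _, hK, h⟩ := h
  refine ⟨K, inferInstance, hK, ?_⟩
  have hn : Measurable fun (κ : ℕ → ℝ) i => -κ i := by fun_prop
  have hKn : K.map (fun κ i => -κ i) = K := Kernel.ext fun x => by
    rw [Kernel.map_apply _ hn]
    exact (hK x).map_neg.unique (hK x)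
  have hl : K.map (fun κ i => -l * κ i) = K.map fun κ i => l * κ i := by
    conv_rhs => rw [← hKn]
    rw [← Kernel.map_comp_right _ hn (by fun_prop)]
    congr 1
    funext κ i
    simp
  rw [← h, ← map_evolve_map (K := K) (g := fun y => -l * y) (by fun_prop),
    ← map_evolve_map (K := K) (g := fun y => l * y) (by fun_prop), hl]

theorem QuasiStationary.linear (hψ : Admissible ψ) {h : ℝ} (hh : deriv ψ h ≠ 0) (hr : 1 ≤ r)
    (hpos : ∀ᵐ x ∂P, ∀ i : ℕ, 0 < x.weight i)
    (hlt : ∀ᵐ x ∂P, ∀ i j : ℕ, i ≠ j → |x.overlap i j| < 1) {β : ℝ} (hβ : β ≠ 0)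
    (hqs : ∀ n : ℕ, QuasiStationary r (fun y => ψ (β / √(n + 1 : ℕ) * y + h)) P) :
    QuasiStationary r (fun y => deriv ψ h * β * y) P := by
  obtain ⟨K, _, hK, -⟩ := hqs 0
  refine ⟨K, inferInstance, hK, ?_⟩
  have hC (x : Space) (i : ℕ) : x.overlap i i ^ r = 1 := by
    rw [show x.overlap i i = 1 from x.2.2.2.2.2.2 i, one_pow]
  have hlt' : ∀ᵐ x ∂P, ∀ i j : ℕ, i ≠ j → |x.overlap i j ^ r| < 1 := by
    filter_upwards [hlt] with x hx i j hij
    rw [abs_pow]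
    exact pow_lt_one₀ (abs_nonneg _) (hx i j hij) (by omega)
  have hinc (a : ℝ) := measurable_increments hψ h a
  have hL (a : ℝ) : IsMarkovKernel (K.map (increments ψ h a)) :=
    Kernel.IsMarkovKernel.map _ (hinc a)
  have hLx (a : ℝ) (x : Space) : K.map (increments ψ h a) x = (K x).map (increments ψ h a) :=
    Kernel.map_apply _ (hinc a) x
  have hpow (n : ℕ) : (P ⊗ₘ powKernel (K.map (increments ψ h (β / √(n + 1 : ℕ)))) n).map
      (evolve id) = P.map Subtype.val := by
    have ha : β / √(n + 1 : ℕ) ≠ 0 :=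
      div_ne_zero hβ (Real.sqrt_ne_zero'.2 (by positivity))
    -- Here any finite bound for the given n is enough; uniformity in n matters only in
    -- `tendsto_integral_convPow`.
    obtain ⟨A, hA⟩ := hψ.exists_lintegral_exp_le h |β / √(n + 1 : ℕ)|
    refine map_evolve_powKernel hpos
      (B := ENNReal.ofReal (Real.exp (A * (β / √(n + 1 : ℕ)) ^ 2))) ENNReal.ofReal_ne_top
      (fun x i => ?_) ?_ ?_ ?_ n
    · rw [hLx, lintegral_exp_increments hψ (hK x) (hC x)]
      exact hA _ le_rfl
    · filter_upwards [hlt'] with x hx i j hij c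
      rw [hLx]
      exact ae_increments_sub_ne hψ (hK x) (hC x) h ha (hx i j hij) c
    · intro x y σ hxy
      have hyK : K y = (K x).map fun κ => κ ∘ σ := by
        refine (hK y).unique ?_
        simp only [hxy]
        exact (hK x).map_comp σ
      have hσ : Measurable fun κ : ℕ → ℝ => κ ∘ σ := by fun_prop
      rw [hLx, hLx, hyK, Measure.map_map (hinc _) hσ, Measure.map_map hσ (hinc _)]
      rfl
    · have hm := hψ.measurable
      rw [← (hqs n).map_evolve_eq hK, ← evolve_sub_const (fun y => ψ _) (ψ h),
        ← map_evolve_map (K := K) (by fun_prop)]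
      rfl
  have hlin : Measurable fun y : ℝ => deriv ψ h * β * y := by fun_prop
  have hev := measurable_evolve hlin
  have : IsProbabilityMeasure ((P ⊗ₘ K).map (evolve fun y => deriv ψ h * β * y)) :=
    Measure.isProbabilityMeasure_map hev.aemeasurable
  have : IsProbabilityMeasure (P.map Subtype.val) :=
    Measure.isProbabilityMeasure_map measurable_subtype_coe.aemeasurable
  refine ext_of_forall_integral_eq_of_IsFiniteMeasure fun f => ?_
  have hfm := f.continuous.measurable
  have hint (A : Kernel Space (ℕ → ℝ)) [IsMarkovKernel A] {g : ℝ → ℝ} (hg : Measurable g) :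
      ∫ z, f z ∂((P ⊗ₘ A).map (evolve g)) = ∫ x, ∫ s, f (evolve g (x, s)) ∂A x ∂P := by
    have hfe : Measurable fun p => f (evolve g p) := hfm.comp (measurable_evolve hg)
    rw [integral_map (measurable_evolve hg).aemeasurable hfm.aestronglyMeasurable]
    exact Measure.integral_compProd (.of_bound hfe.aestronglyMeasurable ‖f‖
      (.of_forall fun p => f.norm_coe_le_norm _))
  rw [hint K hlin]
  -- This sequence is constant by invariance under the iterated evolutions, and it converges to the
  -- expectation under the linear evolution.
  refine tendsto_nhds_unique (f := fun n : ℕ => ∫ x, ∫ s, f (evolve id (x, s))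
    ∂powKernel (K.map (increments ψ h (β / √(n + 1 : ℕ)))) n x ∂P) (l := atTop) ?_ ?_
  · refine tendsto_integral_of_dominated_convergence (fun _ => ‖f‖) (fun n => ?_)
      (integrable_const _) (fun n => .of_forall fun x => ?_) ?_
    · have hfe : Measurable fun p => f (evolve id p) := hfm.comp (measurable_evolve measurable_id)
      exact hfe.stronglyMeasurable.integral_kernel_prod_right'.aestronglyMeasurable
    · refine (norm_integral_le_of_norm_le_const (.of_forall fun s => f.norm_coe_le_norm _)).trans ?_
      simp
    · filter_upwards [hpos, hlt'] with x hx hxlt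
      simp_rw [powKernel_apply, hLx]
      exact tendsto_integral_convPow hψ (hK x) (hC x) hxlt hh hβ hx f
  · refine tendsto_const_nhds.congr fun n => ?_
    rw [← hpow n, hint _ measurable_id]

end QuasiStationary

end ROSt

/-! ### The range of admissible slopes -/

theorem lemmaB1 (ψ : ℝ → ℝ) (hψ : ROSt.Admissible ψ) (h : ℝ) (hh : deriv ψ h ≠ 0)
    (r : ℕ) (hr : 1 ≤ r)
    (P : MeasureTheory.Measure ROSt.Space) [MeasureTheory.IsProbabilityMeasure P]
    (hpos : ∀ᵐ x ∂P, ∀ i : ℕ, 0 < x.weight i)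
    (hlt : ∀ᵐ x ∂P, ∀ i j : ℕ, i ≠ j → |x.overlap i j| < 1)
    (I : Set ℝ) (hI : I.OrdConnected) (hI0 : (0 : ℝ) ∈ I) (hIn : I.Nontrivial)
    (hqs : ∀ β ∈ I, ROSt.QuasiStationary r (fun y => ψ (β * y + h)) P) :
    ∃ ε : ℝ, 0 < ε ∧ ∀ l : ℝ, |l| < ε → ROSt.QuasiStationary r (fun y => l * y) P := by
  obtain ⟨β₀, hβ₀, hβ₀0⟩ := hIn.exists_ne 0
  have hmem {t : ℝ} (h0 : 0 ≤ t) (h1 : t ≤ 1) : t * β₀ ∈ I := by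
    have := hI.uIcc_subset hI0 hβ₀
    refine this ?_
    rcases le_total 0 β₀ with hβ | hβ
    · rw [Set.uIcc_of_le hβ]
      exact ⟨mul_nonneg h0 hβ, mul_le_of_le_one_left hβ h1⟩
    · rw [Set.uIcc_of_ge hβ]
      exact ⟨by nlinarith, mul_nonpos_of_nonneg_of_nonpos h0 hβ⟩
  have hpos' : 0 < |deriv ψ h * β₀| := abs_pos.2 (mul_ne_zero hh hβ₀0)
  have hkey {t : ℝ} (h0 : 0 ≤ t) (h1 : t ≤ 1) :
      ROSt.QuasiStationary r (fun y => deriv ψ h * (t * β₀) * y) P := by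
    rcases h0.eq_or_lt with rfl | h0
    -- For slope zero no limit is needed: ψ(0 · y + h) is constant, and constants do not change the
    -- evolution.
    · obtain ⟨K, hK, hK', hq⟩ := hqs 0 hI0
      refine ⟨K, hK, hK', ?_⟩
      rw [← hq, ← ROSt.evolve_sub_const (fun y => ψ (0 * y + h)) (ψ h)]
      simp
    · refine ROSt.QuasiStationary.linear hψ hh hr hpos hlt (mul_ne_zero h0.ne' hβ₀0) fun n => ?_
      refine hqs _ ?_
      rw [mul_div_right_comm]
      have hs : 1 ≤ √((n + 1 : ℕ) : ℝ) :=
        Real.one_le_sqrt.2 (by exact_mod_cast Nat.succ_pos n)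
      exact hmem (by positivity) ((div_le_self h0.le hs).trans h1)
  refine ⟨|deriv ψ h * β₀|, hpos', fun l hl => ?_⟩
  have ht := hkey (t := |l| / |deriv ψ h * β₀|) (by positivity) ((div_le_one hpos').2 hl.le)
  -- The segment from 0 to β₀ yields slopes of one sign only; the other sign is left to the symmetry
  -- of the field.
  have habs : deriv ψ h * (|l| / |deriv ψ h * β₀| * β₀) = l ∨
      deriv ψ h * (|l| / |deriv ψ h * β₀| * β₀) = -l := by
    rw [← abs_eq_abs, abs_mul, abs_mul, abs_div, abs_abs, abs_abs, abs_mul]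
    have h1 := abs_pos.2 hh
    have h2 := abs_pos.2 hβ₀0
    field_simp
  rcases habs with h1 | h1 <;> rw [h1] at ht
  · exact ht
  · simpa using ht.neg
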